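/- **Setting.** Let $G$ be a directed graph with finite edge set $E$, and let $I$ be a finite set of $N\ge 1$ origin/destination (O/D) pairs. The pair $i$ has a traffic demand $m_i>0$ and a finite non-empty set $\mathcal P_i$ of simple paths from its origin to its destination. Put $\|m\|_1=\sum_i m_i$, $M=\max_i m_i$ and $P=\sum_i|\mathcal P_i|$. A feasible flow is a vector $f\in\mathbb R_{\ge 0}^{P}$ with $\sum_{p\in\mathcal P_i}f_p=m_i$ for all $i$; $\mathcal F$ is the set of feasible flows, and $x_e(f)=\sum_{p\ni e}f_p$ is the load of the edge $e$. The network has a random state $\omega\in\Omega$ with law $\mathbb P$. The cost $c_e(x,\omega)$ of an edge is measurable in $\omega$ and, for $x\in[0,\|m\|_1]$, nonnegative, bounded, non-decreasing in $x$ and Lipschitz in $x$ (uniformly in $\omega$). Write $c_p(f,\omega)=\sum_{e\in p}c_e(x_e(f),\omega)$, $c(f,\omega)=(c_p(f,\omega))_p$, $\bar c(f)=\mathbb E_\omega[c(f,\omega)]$ and $\bar c_e(x)=\mathbb E_\omega[c_e(x,\omega)]$. Let $$\bar\Phi(f)=\sum_e\int_0^{x_e(f)}\bar c_e(u)\,du,\qquad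 \mathrm{Gap}(f)=\bar\Phi(f)-\min_{\mathcal F}\bar\Phi,\qquad \sigma^2=\sup_{f\in\mathcal F}\mathbb E_\omega\|c(f,\omega)-\bar c(f)\|_\infty^2 .$$ Let $L\ge 0$ be a smoothness modulus of $\bar\Phi$, i.e. its gradient $\nabla\bar\Phi=\bar c$ satisfies $\|\bar c(f)-\bar c(f')\|_\infty\le L\|f-f'\|_1$ on $\mathcal F$. **AdaWeight.** Let $\Lambda(Y)_p=m_i\,e^{Y_p}/\sum_{q\in\mathcal P_i}e^{Y_q}$ for $p\in\mathcal P_i$. Take step weights $\alpha_t=t$ and start with $Y^1=0$, $\eta^1=1$. In each epoch $t=1,2,\dots$, with anchor $a^t=\sum_{s<t}\alpha_s y^s$ and $A_t=\sum_{s\le t}\alpha_s$: 1. (test) form the test flow $\tilde x^t=(\alpha_t\Lambda(\eta^tY^t)+a^t)/A_t$, observe $\tilde c^t=c(\tilde x^t,\tilde\omega^t)$ and set $\tilde Y^t=Y^t-\alpha_t\tilde c^t$; 2. (recommendation) set $y^t=\Lambda(\eta^t\tilde Y^t)$, recommend $x^t=(\alpha_ty^t+a^t)/A_t$, observe $c^t=c(x^t,\omega^t)$,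 and set $Y^{t+1}=Y^t-\alpha_tc^t$ and $\eta^{t+1}=\bigl(1+\sum_{s\le t}\|\alpha_s(c^s-\tilde c^s)\|_\infty^2\bigr)^{-1/2}$. The states $\tilde\omega^1,\omega^1,\tilde\omega^2,\omega^2,\dots$ are i.i.d. with law $\mathbb P$. **Theorem.** Let $$C=NM\Bigl[2\log\frac{PM}{\|m\|_1}+13\Bigr]>0,\qquad C'=\|m\|_1\log\frac{PM}{\|m\|_1}\ge 0 .$$ Then for every $T\ge 1$ the random variable $\mathrm{Gap}(x^T)$ is integrable and $$\mathbb E[\mathrm{Gap}(x^T)]\le\frac{2\sqrt2\,C\sigma}{\sqrt T}+\frac{16L\sqrt{NM}\,C^{3/2}+2C'}{T^2}.$$ In the static case $\sigma=0$, almost surely, $\mathrm{Gap}(x^T)\le(16L\sqrt{NM}\,C^{3/2}+2C')/T^2$ for all $T\ge1$. Moreover, there is a constant $K>0$ that depends only on $N$, $M$ and $L$ such that, whenever $P\ge2$: $C\le K\log P$ and $C'\le K\log P$; for all $T\ge 1$, $\mathbb E[\mathrm{Gap}(x^T)]\le K(\log P)^{3/2}\bigl(\sigma/\sqrt T+1/T^2\bigr)$;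 and, if $\sigma=0$, almost surely $\mathrm{Gap}(x^T)\le K(\log P)^{3/2}/T^2$ for all $T\ge1$. -/

import Mathlib

open MeasureTheory ProbabilityTheory

noncomputable section

/-- In the directed graph with edge set `E` and endpoint maps `tail`, `head`, the list of edges `l`
is a walk from `u` to `v`. -/
def IsWalk {V E : Type*} (tail head : E → V) : V → V → List E → Prop
  | u, v, [] => u = v
  | u, v, e :: l => tail e = u ∧ IsWalk tail head (head e) v l

/-- A (simple) path from `u` to `v`: a walk that visits no vertex twice. -/
def IsSimplePath {V E : Type*} (tail head : E → V) (u v : V) (l : List E) : Prop :=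
  IsWalk tail head u v l ∧ (l.map tail ++ [v]).Nodup

/-- A nonatomic congestion game with random costs on the directed (multi)graph with vertices `V` and
edges `E`. `I` is the set of O/D pairs and `Ω` the set of states of the network, with law `law`.
`cost e x s` is the cost of edge `e` under load `x` in state `s`; only loads between `0` and the
total demand can occur, so the regularity of the costs is required on that interval only. -/
structure CongestionGame (V E I Ω : Type*) [Fintype I] [MeasurableSpace Ω] where
  tail : E → V
  head : E → V
  origin : I → V
  dest : I → V
  /-- the traffic demand of each O/D pair -/
  demand : I → ℝ
  demand_pos : ∀ i, 0 < demand i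
  /-- the set of paths that may be recommended to the traffic of each O/D pair -/
  paths : I → Finset (List E)
  paths_nonempty : ∀ i, (paths i).Nonempty
  isPath : ∀ i, ∀ p ∈ paths i, IsSimplePath tail head (origin i) (dest i) p
  law : Measure Ω
  isProbabilityMeasure_law : IsProbabilityMeasure law
  cost : E → ℝ → Ω → ℝ
  cost_measurable : ∀ e, ∀ x ∈ Set.Icc 0 (∑ i, demand i), Measurable (cost e x)
  cost_monotone : ∀ e s, MonotoneOn (fun x => cost e x s) (Set.Icc 0 (∑ i, demand i))
  cost_nonneg : ∀ e s, ∀ x ∈ Set.Icc 0 (∑ i, demand i), 0 ≤ cost e x s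
  cost_bounded : ∃ H : ℝ, ∀ e s, ∀ x ∈ Set.Icc 0 (∑ i, demand i), cost e x s ≤ H
  cost_lipschitz : ∃ K : NNReal, ∀ e s,
    LipschitzOnWith K (fun x => cost e x s) (Set.Icc 0 (∑ i, demand i))

/-- The two phases of an epoch of the algorithm, each of which queries the network once. -/
inductive Phase
  | test
  | recommend

namespace CongestionGame

variable {V E I Ω : Type*} [Fintype E] [Fintype I] [MeasurableSpace Ω]
  (G : CongestionGame V E I Ω)

/-- The paths of all O/D pairs, each labelled with its O/D pair. -/
abbrev Route : Type _ := (i : I) × {p : List E // p ∈ G.paths i}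

/-- `P`, the number of paths. -/
def numPaths : ℕ := Fintype.card G.Route

/-- `‖m‖₁`, the total demand. -/
def totalDemand : ℝ := ∑ i, G.demand i

/-- `M`, the largest demand. -/
def maxDemand : ℝ := ⨆ i, G.demand i

/-- The feasible flows. -/
def feasible : Set (G.Route → ℝ) :=
  {f | (∀ r, 0 ≤ f r) ∧ ∀ i, ∑ p : {p : List E // p ∈ G.paths i}, f ⟨i, p⟩ = G.demand i}

open scoped Classical in
/-- The load of the edge `e` under the flow `f`. -/
def load (f : G.Route → ℝ) (e : E) : ℝ :=
  ∑ r : G.Route, if e ∈ r.2.1 then f r else 0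

/-- The vector of path costs under the flow `f` in state `s`. -/
def pathCost (f : G.Route → ℝ) (s : Ω) : G.Route → ℝ :=
  fun r => (r.2.1.map fun e => G.cost e (G.load f e) s).sum

/-- The vector of mean path costs under the flow `f`; it is the gradient of `potential` at `f`. -/
def meanPathCost (f : G.Route → ℝ) : G.Route → ℝ :=
  fun r => ∫ s, G.pathCost f s r ∂G.law

/-- The mean cost of the edge `e` under the load `x`. -/
def meanCost (e : E) (x : ℝ) : ℝ := ∫ s, G.cost e x s ∂G.law

/-- The mean Beckmann-McGuire-Winsten potential. -/
def potential (f : G.Route → ℝ) : ℝ := ∑ e, ∫ u in (0 : ℝ)..G.load f e, G.meanCost e u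

/-- The equilibrium gap of a flow. -/
def gap (f : G.Route → ℝ) : ℝ := G.potential f - sInf (G.potential '' G.feasible)

/-- The potential is `L`-smooth with respect to the `ℓ¹` norm: its gradient, the vector of mean path
costs, is `L`-Lipschitz from the `ℓ¹` norm to the supremum norm. -/
def IsSmoothWith (L : ℝ) : Prop :=
  ∀ f ∈ G.feasible, ∀ g ∈ G.feasible,
    ‖G.meanPathCost f - G.meanPathCost g‖ ≤ L * ∑ r, |f r - g r|

/-- `σ`, where `σ²` is the supremum over all feasible flows of the variance of the path costs in the
supremum norm. -/
def noiseLevel : ℝ :=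
  √(⨆ f : G.feasible, ∫ s, ‖G.pathCost f s - G.meanPathCost f‖ ^ 2 ∂G.law)

/-- The logit map. -/
def logit (Y : G.Route → ℝ) : G.Route → ℝ :=
  fun r => G.demand r.1 * Real.exp (Y r) /
    ∑ q : {p : List E // p ∈ G.paths r.1}, Real.exp (Y ⟨r.1, q⟩)

/-- What AdaWeight remembers at the start of epoch `t`: the anchor `∑_{s < t} αₛ yˢ`, the path scores
`Yᵗ`, and the sum `∑_{s < t} ‖αₛ (cˢ - c̃ˢ)‖²` that determines the learning rate. -/
structure Memory where
  anchor : G.Route → ℝ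
  score : G.Route → ℝ
  sqSum : ℝ

namespace Memory

variable {G}
variable (m : G.Memory) (α : ℕ → ℝ) (t : ℕ)

/-- the learning rate `ηᵗ` -/
def rate : ℝ := 1 / √(1 + m.sqSum)

/-- `(αₜ y + anchor) / ∑_{s ≤ t} αₛ` -/
def average (y : G.Route → ℝ) : G.Route → ℝ :=
  (∑ s ∈ Finset.range (t + 1), α s)⁻¹ • (α t • y + m.anchor)

/-- the test flow of epoch `t` -/
def testFlow : G.Route → ℝ := m.average α t (G.logit (m.rate • m.score))

/-- the exploratory scores of epoch `t`, when the test flow is queried in state `s₁` -/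
def testScore (s₁ : Ω) : G.Route → ℝ := m.score - α t • G.pathCost (m.testFlow α t) s₁

/-- the leading flow `yᵗ` of the recommendation phase -/
def leadFlow (s₁ : Ω) : G.Route → ℝ := G.logit (m.rate • m.testScore α t s₁)

/-- the recommended flow `xᵗ` -/
def recommendedFlow (s₁ : Ω) : G.Route → ℝ := m.average α t (m.leadFlow α t s₁)

/-- The memory after epoch `t`, in which the test flow is queried in state `s₁` and the traffic is
routed according to the recommended flow in state `s₂`. -/
def next (s₁ s₂ : Ω) : G.Memory where
  anchor := m.anchor + α t • m.leadFlow α t s₁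
  score := m.score - α t • G.pathCost (m.recommendedFlow α t s₁) s₂
  sqSum := m.sqSum + ‖α t • (G.pathCost (m.recommendedFlow α t s₁) s₂ -
    G.pathCost (m.testFlow α t) s₁)‖ ^ 2

end Memory

/-- The memory of AdaWeight with step weights `α` after the epochs `1, …, n`, when `s t φ` is the
state of the network in phase `φ` of epoch `t`. -/
def memory (α : ℕ → ℝ) (s : ℕ → Phase → Ω) : ℕ → G.Memory
  | 0 => ⟨0, 0, 0⟩
  | n + 1 => (memory α s n).next α (n + 1) (s (n + 1) Phase.test) (s (n + 1) Phase.recommend)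

/-- The flow that AdaWeight with step weights `α` recommends in epoch `t ≥ 1`. -/
def adaWeight (α : ℕ → ℝ) (s : ℕ → Phase → Ω) (t : ℕ) : G.Route → ℝ :=
  (G.memory α s (t - 1)).recommendedFlow α t (s t Phase.test)

/-- `C = N M (2 log (P M / ‖m‖₁) + 13)` -/
def constC : ℝ :=
  Fintype.card I * G.maxDemand *
    (2 * Real.log (G.numPaths * G.maxDemand / G.totalDemand) + 13)

/-- `C' = ‖m‖₁ log (P M / ‖m‖₁)` -/
def constC' : ℝ :=
  G.totalDemand * Real.log (G.numPaths * G.maxDemand / G.totalDemand)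

end CongestionGame

end

/-! Because `xᵗ` is the weighted average of `y¹, …, yᵗ`, convexity of the mean potential bounds
`A_T Gap(xᵀ)` by the weighted regret of the flows `yᵗ` for the mean costs at the *averaged*
flows `xᵗ`. The flow `yᵗ` is the logit response to scores that include the test costs as a
prediction of the costs of the epoch. With the rescaled log-partition function as energy, the
regret is thus at most `C'` plus a multiple of `√(1 + ∑ ‖αₜ (cᵗ - c̃ᵗ)‖²)`, minus multiples of
`‖yᵗ - Λ(ηᵗ Yᵗ)‖₁² / ηᵗ`.

The flows `xᵗ` and `x̃ᵗ` differ by `(αₜ / Aₜ) (yᵗ - Λ(ηᵗ Yᵗ))`, so by smoothness and `αₜ² ≤ 2 Aₜ`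
the prediction error `αₜ (cᵗ - c̃ᵗ)` is at most `2 L ‖yᵗ - Λ(ηᵗ Yᵗ)‖₁` plus noise. The negative
terms absorb the first part up to a constant, since their coefficients `1 / ηᵗ` grow as soon as
the prediction errors do. The noise contributes its root mean square, and the noise in the regret
itself has mean zero because `yᵗ` is independent of the state in which the costs `cᵗ` are
observed. -/

noncomputable section

theorem sq_sqrt_sub_sqrt_le_mul_log_sub {y z : ℝ} (hy : 0 < y) (hz : 0 < z) :
    (√y - √z) ^ 2 ≤ y * (Real.log y - Real.log z) - y + z := by
  have hys := Real.sqrt_pos.2 hy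
  have hzs := Real.sqrt_pos.2 hz
  have hlog := Real.log_le_sub_one_of_pos (div_pos hzs hys)
  rw [Real.log_div hzs.ne' hys.ne', Real.log_sqrt hz.le, Real.log_sqrt hy.le] at hlog
  have hmul := mul_le_mul_of_nonneg_left hlog hy.le
  have hdiv : y * (√z / √y - 1) = √y * √z - y := by
    field_simp
    linear_combination √z * (Real.sq_sqrt hy.le).symm
  linarith [sub_sq √y √z, Real.sq_sqrt hy.le, Real.sq_sqrt hz.le]

theorem sq_sum_abs_sub_le_sum_sq_sqrt_sub_sqrt_mul {ι : Type*} (s : Finset ι) {y z : ι → ℝ}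
    (hy : ∀ r ∈ s, 0 ≤ y r) (hz : ∀ r ∈ s, 0 ≤ z r) :
    (∑ r ∈ s, |y r - z r|) ^ 2 ≤
      (∑ r ∈ s, (√(y r) - √(z r)) ^ 2) * (2 * (∑ r ∈ s, y r + ∑ r ∈ s, z r)) := by
  have hfactor : ∀ r ∈ s, |y r - z r| = |√(y r) - √(z r)| * (√(y r) + √(z r)) := fun r hr => by
    rw [← abs_of_nonneg (add_nonneg (Real.sqrt_nonneg (y r)) (Real.sqrt_nonneg (z r))), ← abs_mul]
    congr 1
    linear_combination Real.sq_sqrt (hz r hr) - Real.sq_sqrt (hy r hr)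
  have hsum : ∑ r ∈ s, (√(y r) + √(z r)) ^ 2 ≤ 2 * (∑ r ∈ s, y r + ∑ r ∈ s, z r) := by
    rw [← Finset.sum_add_distrib, Finset.mul_sum]
    exact Finset.sum_le_sum fun r hr => by
      simpa only [Real.sq_sqrt (hy r hr), Real.sq_sqrt (hz r hr)] using add_sq_le (a := √(y r))
        (b := √(z r))
  calc (∑ r ∈ s, |y r - z r|) ^ 2
      = (∑ r ∈ s, |√(y r) - √(z r)| * (√(y r) + √(z r))) ^ 2 := by
        rw [Finset.sum_congr rfl hfactor]
    _ ≤ (∑ r ∈ s, |√(y r) - √(z r)| ^ 2) * ∑ r ∈ s, (√(y r) + √(z r)) ^ 2 :=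
        Finset.sum_mul_sq_le_sq_mul_sq _ _ _
    _ ≤ _ := by
        simp only [sq_abs]
        gcongr

/-- A form of Pinsker's inequality for vectors of mass `c`; it goes through the squared Hellinger
distance and loses a factor `2` against the sharp constant. -/
theorem sq_sum_abs_sub_le_four_mul_sum_mul_log {ι : Type*} (s : Finset ι) {y z : ι → ℝ} {c : ℝ}
    (hy : ∀ r ∈ s, 0 < y r) (hz : ∀ r ∈ s, 0 < z r) (hyc : ∑ r ∈ s, y r = c)
    (hzc : ∑ r ∈ s, z r = c) :
    (∑ r ∈ s, |y r - z r|) ^ 2 ≤ 4 * c * ∑ r ∈ s, y r * (Real.log (y r) - Real.log (z r)) := by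
  have hellinger : ∑ r ∈ s, (√(y r) - √(z r)) ^ 2 ≤
      ∑ r ∈ s, y r * (Real.log (y r) - Real.log (z r)) :=
    calc ∑ r ∈ s, (√(y r) - √(z r)) ^ 2
        ≤ ∑ r ∈ s, (y r * (Real.log (y r) - Real.log (z r)) - y r + z r) :=
          Finset.sum_le_sum fun r hr => sq_sqrt_sub_sqrt_le_mul_log_sub (hy r hr) (hz r hr)
      _ = ∑ r ∈ s, y r * (Real.log (y r) - Real.log (z r)) := by
          rw [Finset.sum_add_distrib, Finset.sum_sub_distrib, hyc, hzc, sub_add_cancel]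
  have hc : 0 ≤ c := hyc ▸ Finset.sum_nonneg fun r hr => (hy r hr).le
  calc (∑ r ∈ s, |y r - z r|) ^ 2
      ≤ (∑ r ∈ s, (√(y r) - √(z r)) ^ 2) * (2 * (∑ r ∈ s, y r + ∑ r ∈ s, z r)) :=
        sq_sum_abs_sub_le_sum_sq_sqrt_sub_sqrt_mul s (fun r hr => (hy r hr).le)
          fun r hr => (hz r hr).le
    _ = 4 * c * ∑ r ∈ s, (√(y r) - √(z r)) ^ 2 := by rw [hyc, hzc]; ring
    _ ≤ _ := by gcongr

theorem abs_dotProduct_le_norm_mul_sum_abs {ι : Type*} [Fintype ι] (u v : ι → ℝ) :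
    |u ⬝ᵥ v| ≤ ‖u‖ * ∑ r, |v r| := by
  rw [dotProduct, Finset.mul_sum]
  refine (Finset.abs_sum_le_sum_abs _ _).trans (Finset.sum_le_sum fun r _ => ?_)
  rw [abs_mul]
  exact mul_le_mul_of_nonneg_right (norm_le_pi_norm u r) (abs_nonneg _)

theorem rpow_three_halves {x : ℝ} (hx : 0 ≤ x) : x ^ (3 / 2 : ℝ) = x * √x := by
  rw [Real.sqrt_eq_rpow, ← Real.rpow_one_add' hx (by norm_num)]
  norm_num

theorem sqrt_sub_sqrt_le_div {x y : ℝ} (hx : 0 < x) (hy : 0 ≤ y) :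
    √y - √x ≤ (y - x) / (2 * √x) := by
  rw [le_div_iff₀ (mul_pos two_pos (Real.sqrt_pos.2 hx))]
  nlinarith [sq_nonneg (√y - √x), Real.sq_sqrt hx.le, Real.sq_sqrt hy]

theorem mul_sub_mul_sq_div_le_sqrt_sub {s a D m : ℝ} (hs : 0 < s) (ha : 0 ≤ a) (hD : D ≤ 2 * m)
    (hm : 0 < m) : a * D - s * D ^ 2 / (4 * m) ≤ 4 * m * (√(s ^ 2 + a ^ 2) - s) := by
  have hS := Real.sq_sqrt (add_nonneg (sq_nonneg s) (sq_nonneg a))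
  set S := √(s ^ 2 + a ^ 2)
  have hS0 : 0 ≤ S := Real.sqrt_nonneg _
  have hsS : s ≤ S := by nlinarith
  rcases le_total a (2 * s) with hsmall | hlarge
  · have hSs : S ≤ 3 * s := by nlinarith
    have hquad : a * D - s * D ^ 2 / (4 * m) ≤ m * (a ^ 2 / s) := by
      have hsquare : m * (a ^ 2 / s) - (a * D - s * D ^ 2 / (4 * m)) =
          (2 * m * a - s * D) ^ 2 / (4 * m * s) := by
        field_simp
        ring
      have : 0 ≤ (2 * m * a - s * D) ^ 2 / (4 * m * s) := by positivity
      linarith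
    have hincr : a ^ 2 / s ≤ 4 * (S - s) := by
      rw [div_le_iff₀ hs]
      nlinarith [mul_nonneg (sub_nonneg.2 hsS) (sub_nonneg.2 hSs)]
    linarith [mul_le_mul_of_nonneg_left hincr hm.le]
  · have haS : a ≤ S := Real.le_sqrt_of_sq_le (by linarith [sq_nonneg s])
    have : 0 ≤ s * D ^ 2 / (4 * m) := by positivity
    have hincr : a ≤ 2 * (S - s) := by linarith
    linarith [mul_le_mul_of_nonneg_left hD ha, mul_le_mul_of_nonneg_left hincr hm.le]

/-- As long as `U k` is small, so is `√(U (k + 1))`; once `U k` is large, the increment of `√(U k)`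
is absorbed by the `k`-th term of the sum. -/
theorem mul_sqrt_sub_sqrt_sub_sum_le {U q : ℕ → ℝ} {b c γ Q : ℝ} (hb : 0 ≤ b) (hc : 0 ≤ c)
    (hγ : 0 < γ) (hU0 : 0 < U 0) (hU : Monotone U) (hstep : ∀ k, U (k + 1) ≤ U k + b * q k)
    (hq : ∀ k, 0 ≤ q k) (hqQ : ∀ k, q k ≤ Q) (n : ℕ) :
    c * (√(U n) - √(U 0)) - ∑ k ∈ Finset.range n, γ * √(U k) * q k ≤
      c * √(b * (c / (2 * γ) + Q)) := by
  induction n with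
  | zero =>
    rw [sub_self, mul_zero, Finset.range_zero, Finset.sum_empty, sub_zero]
    positivity
  | succ k ih =>
    have hUk : 0 < U k := hU0.trans_le (hU k.zero_le)
    rcases le_total (b * (c / (2 * γ))) (U k) with hlarge | hsmall
    · have hsqrt_pos := Real.sqrt_pos.2 hUk
      have habsorb : c * (√(U (k + 1)) - √(U k)) ≤ γ * √(U k) * q k :=
        calc c * (√(U (k + 1)) - √(U k)) ≤ c * (b * q k / (2 * √(U k))) := by
              gcongr
              refine (sqrt_sub_sqrt_le_div hUk (hUk.le.trans (hU k.le_succ))).trans ?_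
              gcongr
              linarith [hstep k]
          _ = b * (c / (2 * γ)) * (γ * q k / √(U k)) := by field_simp [hsqrt_pos.ne']
          _ ≤ U k * (γ * q k / √(U k)) := by
              have := hq k
              gcongr
          _ = γ * √(U k) * q k := by
              nth_rewrite 1 [← Real.sq_sqrt hUk.le]
              field_simp
      rw [Finset.sum_range_succ]
      linarith
    · have hbound : √(U (k + 1)) ≤ √(b * (c / (2 * γ) + Q)) := by
        refine Real.sqrt_le_sqrt ((hstep k).trans ?_)
        linarith [mul_le_mul_of_nonneg_left (hqQ k) hb]
      have hsum : 0 ≤ ∑ j ∈ Finset.range (k + 1), γ * √(U j) * q j :=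
        Finset.sum_nonneg fun j _ => mul_nonneg (by positivity) (hq j)
      linarith [mul_le_mul_of_nonneg_left hbound hc, mul_nonneg hc (Real.sqrt_nonneg (U 0))]

theorem sqrt_add_le_add_sqrt {x y : ℝ} (hx : 0 ≤ x) (hy : 0 ≤ y) : √(x + y) ≤ √x + √y :=
  Real.sqrt_le_iff.2 ⟨by positivity, by
    nlinarith [Real.sq_sqrt hx, Real.sq_sqrt hy, mul_nonneg (Real.sqrt_nonneg x)
      (Real.sqrt_nonneg y)]⟩

/-- The part of `a k ^ 2` that is due to `d k`, rather than to the noise `ν k`, is at most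
`min (a k ^ 2) (8 * L ^ 2 * d k ^ 2)`, and only this part has to be compensated by the sum. -/
theorem mul_sqrt_one_add_sum_sub_one_sub_sum_le {a d ν : ℕ → ℝ} {c γ D L : ℝ} (hc : 0 ≤ c)
    (hγ : 0 < γ) (ha : ∀ k, 0 ≤ a k) (hd : ∀ k, 0 ≤ d k) (hdD : ∀ k, d k ≤ D)
    (had : ∀ k, a k ≤ 2 * L * d k + ν k) (n : ℕ) :
    c * (√(1 + ∑ k ∈ Finset.range n, a k ^ 2) - 1) -
        ∑ k ∈ Finset.range n, γ * √(1 + ∑ j ∈ Finset.range k, a j ^ 2) * d k ^ 2 ≤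
      c * √(2 * ∑ k ∈ Finset.range n, ν k ^ 2) + c * √(8 * L ^ 2 * (c / (2 * γ) + D ^ 2)) := by
  set e : ℕ → ℝ := fun k => min (a k ^ 2) (8 * L ^ 2 * d k ^ 2) with he
  set U : ℕ → ℝ := fun n => 1 + ∑ k ∈ Finset.range n, e k with hU
  have hU_succ : ∀ k, U (k + 1) = U k + e k := fun k => by
    simp only [hU, Finset.sum_range_succ, add_assoc]
  have hU_mono : Monotone U := monotone_nat_of_le_succ fun k => by
    rw [hU_succ]
    exact le_add_of_nonneg_right (le_min (sq_nonneg _) (by positivity))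
  have hU_le : ∀ k, U k ≤ 1 + ∑ j ∈ Finset.range k, a j ^ 2 := fun k => by
    simp only [hU]
    gcongr
    exact min_le_left _ _
  have hU_zero : U 0 = 1 := by simp [hU]
  have hsq : ∀ k, a k ^ 2 ≤ e k + 2 * ν k ^ 2 := fun k => by
    simp only [he]
    rw [min_add, le_min_iff]
    exact ⟨le_add_of_nonneg_right (by positivity), by
      nlinarith [pow_le_pow_left₀ (ha k) (had k) 2, sq_nonneg (2 * L * d k - ν k)]⟩
  have hsqrt : √(1 + ∑ k ∈ Finset.range n, a k ^ 2) ≤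
      √(U n) + √(2 * ∑ k ∈ Finset.range n, ν k ^ 2) := by
    refine (Real.sqrt_le_sqrt ?_).trans (sqrt_add_le_add_sqrt
      (zero_le_one.trans (hU_zero ▸ hU_mono n.zero_le)) (by positivity))
    rw [add_assoc, Finset.mul_sum, ← Finset.sum_add_distrib]
    gcongr with k
    exact hsq k
  have hsum : ∑ k ∈ Finset.range n, γ * √(U k) * d k ^ 2 ≤
      ∑ k ∈ Finset.range n, γ * √(1 + ∑ j ∈ Finset.range k, a j ^ 2) * d k ^ 2 := by
    gcongr with k
    exact hU_le k
  have hmain := mul_sqrt_sub_sqrt_sub_sum_le (U := U) (q := fun k => d k ^ 2) (b := 8 * L ^ 2)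
    (by positivity) hc hγ
    (hU_zero ▸ one_pos) hU_mono
    (fun k => (hU_succ k).trans_le (by gcongr; exact min_le_right _ _))
    (fun k => sq_nonneg _) (fun k => pow_le_pow_left₀ (hd k) (hdD k) 2) n
  rw [hU_zero, Real.sqrt_one] at hmain
  linarith [mul_le_mul_of_nonneg_left hsqrt hc]

theorem mul_sub_le_integral_of_monotoneOn {φ : ℝ → ℝ} {x y : ℝ}
    (hφ : MonotoneOn φ (Set.uIcc x y)) : φ x * (y - x) ≤ ∫ u in x..y, φ u := by
  have hint := hφ.intervalIntegrable (μ := volume)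
  rcases le_total x y with hxy | hxy
  · rw [Set.uIcc_of_le hxy] at hφ
    have h := intervalIntegral.integral_mono_on hxy intervalIntegrable_const hint
      fun u hu => hφ (Set.left_mem_Icc.2 hxy) hu hu.1
    rwa [intervalIntegral.integral_const, smul_eq_mul, mul_comm] at h
  · rw [Set.uIcc_of_ge hxy] at hφ
    have h := intervalIntegral.integral_mono_on hxy hint.symm intervalIntegrable_const
      fun u hu => hφ hu (Set.right_mem_Icc.2 hxy) hu.2
    rw [intervalIntegral.integral_const, smul_eq_mul] at h
    rw [intervalIntegral.integral_symm]
    linarith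

theorem sum_mul_sub_le_sum_mul_dotProduct {ι : Type*} [Fintype ι] {K : Set (ι → ℝ)}
    {Φ : (ι → ℝ) → ℝ} {g : (ι → ℝ) → ι → ℝ}
    (hΦ : ∀ x ∈ K, ∀ z ∈ K, Φ x + g x ⬝ᵥ (z - x) ≤ Φ z) {α : ℕ → ℝ} (hα : ∀ k, 0 ≤ α k)
    {x y : ℕ → ι → ℝ} (hxK : ∀ k, x k ∈ K)
    (hxy : ∀ n, (∑ k ∈ Finset.range (n + 1), α k) • x n = ∑ k ∈ Finset.range (n + 1), α k • y k)
    {z : ι → ℝ} (hz : z ∈ K) (n : ℕ) :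
    (∑ k ∈ Finset.range (n + 1), α k) * (Φ (x n) - Φ z) ≤
      ∑ k ∈ Finset.range (n + 1), α k * (g (x k) ⬝ᵥ (y k - z)) := by
  induction n with
  | zero =>
    have hfirst : α 0 • x 0 = α 0 • y 0 := by simpa using hxy 0
    have hdot := congrArg (g (x 0) ⬝ᵥ ·) hfirst
    have htangent := mul_le_mul_of_nonneg_left (hΦ _ (hxK 0) z hz) (hα 0)
    simp only [dotProduct_smul, smul_eq_mul, dotProduct_sub] at hdot htangent
    simp only [zero_add, Finset.sum_range_one, dotProduct_sub]
    linarith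
  | succ n ih =>
    have hA : 0 ≤ ∑ k ∈ Finset.range (n + 1), α k := Finset.sum_nonneg fun k _ => hα k
    have haverage := hxy (n + 1)
    rw [Finset.sum_range_succ, Finset.sum_range_succ (fun k => α k • y k), ← hxy n] at haverage
    rw [Finset.sum_range_succ, Finset.sum_range_succ (fun k => α k * _)]
    set A := ∑ k ∈ Finset.range (n + 1), α k
    have hdot := congrArg (g (x (n + 1)) ⬝ᵥ ·) haverage
    have hprev := mul_le_mul_of_nonneg_left (hΦ _ (hxK (n + 1)) _ (hxK n)) hA
    have htangent := mul_le_mul_of_nonneg_left (hΦ _ (hxK (n + 1)) z hz) (hα (n + 1))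
    simp only [dotProduct_smul, dotProduct_add, smul_eq_mul, dotProduct_sub]
      at ih hdot hprev htangent ⊢
    linarith

section Probability

variable {Ξ S Ω ι : Type*} {mΞ : MeasurableSpace Ξ} [MeasurableSpace S] [mΩ : MeasurableSpace Ω]
  {μ : Measure Ξ}

theorem integral_comp_prodMk_of_indepFun {F : Type*} [NormedAddCommGroup F] [NormedSpace ℝ F]
    [IsFiniteMeasure μ] {X : Ξ → S} {W : Ξ → Ω} (hX : AEMeasurable X μ) (hW : AEMeasurable W μ)
    (hind : IndepFun X W μ) {g : S × Ω → F} (hg : Integrable g ((μ.map X).prod (μ.map W))) :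
    ∫ ξ, g (X ξ, W ξ) ∂μ = ∫ ξ, ∫ w, g (X ξ, w) ∂μ.map W ∂μ := by
  have hmap := (indepFun_iff_map_prod_eq_prod_map_map hX hW).1 hind
  calc ∫ ξ, g (X ξ, W ξ) ∂μ = ∫ p, g p ∂(μ.map X).prod (μ.map W) := by
        rw [← hmap] at hg ⊢
        exact (integral_map (hX.prodMk hW) hg.aestronglyMeasurable).symm
    _ = ∫ x, ∫ w, g (x, w) ∂μ.map W ∂μ.map X := integral_prod _ hg
    _ = ∫ ξ, ∫ w, g (X ξ, w) ∂μ.map W ∂μ :=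
        integral_map hX hg.integral_prod_left.aestronglyMeasurable

theorem measurable_iSup_comap_of_mem (ω : ι → Ξ → Ω) {J : Set ι} {j : ι} (hj : j ∈ J) :
    Measurable[⨆ i ∈ J, mΩ.comap (ω i)] (ω j) :=
  measurable_iff_comap_le.2 (le_iSup₂ (f := fun i _ => mΩ.comap (ω i)) j hj)

theorem indepFun_of_measurable_iSup_comap {ω : ι → Ξ → Ω} (hω : ∀ j, Measurable (ω j))
    (hind : iIndepFun ω μ) {J : Set ι} {j : ι} (hj : j ∉ J) {X : Ξ → S}
    (hX : Measurable[⨆ i ∈ J, mΩ.comap (ω i)] X) : IndepFun X (ω j) μ := by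
  rw [IndepFun_iff_Indep]
  have h := indep_iSup_of_disjoint (fun i => (hω i).comap_le) hind.iIndep
    (Set.disjoint_singleton_right.2 hj)
  rw [iSup_singleton] at h
  exact indep_of_indep_of_le_left h hX.comap_le

theorem ae_eq_zero_of_integral_sq_norm_nonpos {F : Type*} [NormedAddCommGroup F] {Y : Ξ → F}
    (hY : Integrable (fun ξ => ‖Y ξ‖ ^ 2) μ) (hle : ∫ ξ, ‖Y ξ‖ ^ 2 ∂μ ≤ 0) : Y =ᵐ[μ] 0 := by
  have hzero := (integral_eq_zero_iff_of_nonneg (fun _ => sq_nonneg _) hY).1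
    (hle.antisymm (integral_nonneg fun _ => sq_nonneg _))
  filter_upwards [hzero] with ξ hξ
  simpa using hξ

variable [IsProbabilityMeasure μ] {X : Ξ → ℝ}

theorem integrable_sqrt (hX : Integrable X μ) : Integrable (fun ξ => √(X ξ)) μ := by
  refine (hX.norm.add (integrable_const 1)).mono'
    (Real.continuous_sqrt.comp_aestronglyMeasurable hX.aestronglyMeasurable)
    (Filter.Eventually.of_forall fun ξ => ?_)
  rw [Real.norm_of_nonneg (Real.sqrt_nonneg _), Pi.add_apply, Real.norm_eq_abs]
  exact Real.sqrt_le_iff.2 ⟨by positivity, by nlinarith [le_abs_self (X ξ), abs_nonneg (X ξ)]⟩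

theorem integral_sqrt_le_sqrt_integral (hX : Integrable X μ) (hX_nonneg : 0 ≤ᵐ[μ] X) :
    ∫ ξ, √(X ξ) ∂μ ≤ √(∫ ξ, X ξ ∂μ) :=
  Real.strictConcaveOn_sqrt.concaveOn.le_map_integral Real.continuous_sqrt.continuousOn
    isClosed_Ici hX_nonneg hX (integrable_sqrt hX)

end Probability

namespace CongestionGame

variable {V E I Ω : Type*} [Fintype I] [MeasurableSpace Ω] (G : CongestionGame V E I Ω)

instance (i : I) : Nonempty {p : List E // p ∈ G.paths i} :=
  (G.paths_nonempty i).to_subtype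

instance : IsProbabilityMeasure G.law := G.isProbabilityMeasure_law

section Demand

theorem totalDemand_nonneg : 0 ≤ G.totalDemand :=
  Finset.sum_nonneg fun i _ => (G.demand_pos i).le

theorem totalDemand_pos [Nonempty I] : 0 < G.totalDemand :=
  Finset.sum_pos (fun i _ => G.demand_pos i) Finset.univ_nonempty

theorem demand_le_maxDemand (i : I) : G.demand i ≤ G.maxDemand :=
  le_ciSup (Set.finite_range _).bddAbove i

theorem maxDemand_nonneg : 0 ≤ G.maxDemand :=
  Real.iSup_nonneg fun i => (G.demand_pos i).le

theorem totalDemand_le : G.totalDemand ≤ Fintype.card I * G.maxDemand := by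
  rw [totalDemand, ← nsmul_eq_mul]
  exact Finset.sum_le_card_nsmul _ _ _ fun i _ => G.demand_le_maxDemand i

theorem numPaths_eq_sum_card : (G.numPaths : ℝ) = ∑ i, ((G.paths i).card : ℝ) := by
  simp only [numPaths, Fintype.card_sigma, Fintype.card_coe, Nat.cast_sum]

theorem one_le_card_paths (i : I) : (1 : ℝ) ≤ (G.paths i).card := by
  exact_mod_cast (G.paths_nonempty i).card_pos

theorem sum_demand_mul_card_le :
    ∑ i, G.demand i * ((G.paths i).card : ℝ) ≤ G.numPaths * G.maxDemand := by
  rw [numPaths_eq_sum_card, Finset.sum_mul]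
  refine Finset.sum_le_sum fun i _ => ?_
  rw [mul_comm]
  exact mul_le_mul_of_nonneg_left (G.demand_le_maxDemand i) (Nat.cast_nonneg _)

theorem totalDemand_le_numPaths_mul : G.totalDemand ≤ G.numPaths * G.maxDemand :=
  (Finset.sum_le_sum fun i _ => le_mul_of_one_le_right (G.demand_pos i).le
    (G.one_le_card_paths i)).trans G.sum_demand_mul_card_le

theorem log_ratio_nonneg [Nonempty I] :
    0 ≤ Real.log (G.numPaths * G.maxDemand / G.totalDemand) :=
  Real.log_nonneg ((one_le_div G.totalDemand_pos).2 G.totalDemand_le_numPaths_mul)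

theorem constC'_nonneg [Nonempty I] : 0 ≤ G.constC' :=
  mul_nonneg G.totalDemand_nonneg G.log_ratio_nonneg

theorem two_mul_constC'_add_le_constC [Nonempty I] :
    2 * G.constC' + 13 * G.totalDemand ≤ G.constC := by
  have h := mul_le_mul_of_nonneg_right G.totalDemand_le
    (add_nonneg (mul_nonneg zero_le_two G.log_ratio_nonneg) (by norm_num : (0 : ℝ) ≤ 13))
  rw [constC, constC']
  linarith

theorem card_mul_maxDemand_le_constC [Nonempty I] :
    Fintype.card I * G.maxDemand ≤ G.constC := by
  refine le_mul_of_one_le_right (mul_nonneg (Nat.cast_nonneg _) G.maxDemand_nonneg) ?_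
  linarith [G.log_ratio_nonneg]

theorem constC_pos [Nonempty I] : 0 < G.constC :=
  (G.totalDemand_pos.trans_le G.totalDemand_le).trans_le G.card_mul_maxDemand_le_constC

end Demand

section Feasible

variable {G} {f g : G.Route → ℝ}

theorem sum_mul_fst_of_mem_feasible (hf : f ∈ G.feasible) (a : I → ℝ) :
    ∑ r, f r * a r.1 = ∑ i, G.demand i * a i := by
  rw [Fintype.sum_sigma]
  refine Finset.sum_congr rfl fun i _ => ?_
  rw [← hf.2 i, Finset.sum_mul]

theorem sum_of_mem_feasible (hf : f ∈ G.feasible) : ∑ r, f r = G.totalDemand := by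
  simpa only [mul_one, totalDemand] using sum_mul_fst_of_mem_feasible hf fun _ => 1

theorem sum_abs_sub_le_of_mem_feasible (hf : f ∈ G.feasible) (hg : g ∈ G.feasible) :
    ∑ r, |f r - g r| ≤ 2 * G.totalDemand :=
  calc ∑ r, |f r - g r| ≤ ∑ r, (f r + g r) := Finset.sum_le_sum fun r _ => by
        rw [abs_le]
        constructor <;> linarith [hf.1 r, hg.1 r]
    _ = 2 * G.totalDemand := by
        rw [Finset.sum_add_distrib, sum_of_mem_feasible hf, sum_of_mem_feasible hg, two_mul]

theorem convex_feasible : Convex ℝ G.feasible := fun f hf g hg a b ha hb hab =>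
  ⟨fun r => add_nonneg (mul_nonneg ha (hf.1 r)) (mul_nonneg hb (hg.1 r)), fun i => by
    simp only [Pi.add_apply, Pi.smul_apply, smul_eq_mul]
    rw [Finset.sum_add_distrib, ← Finset.mul_sum, ← Finset.mul_sum, hf.2, hg.2, ← add_mul, hab,
      one_mul]⟩

end Feasible

section Logit

theorem sum_exp_pos (Y : G.Route → ℝ) (i : I) :
    0 < ∑ q : {p : List E // p ∈ G.paths i}, Real.exp (Y ⟨i, q⟩) :=
  Finset.sum_pos (fun _ _ => Real.exp_pos _) Finset.univ_nonempty

theorem logit_pos (Y : G.Route → ℝ) (r : G.Route) : 0 < G.logit Y r :=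
  div_pos (mul_pos (G.demand_pos _) (Real.exp_pos _)) (G.sum_exp_pos Y r.1)

theorem logit_mem_feasible (Y : G.Route → ℝ) : G.logit Y ∈ G.feasible := by
  refine ⟨fun r => (G.logit_pos Y r).le, fun i => ?_⟩
  change ∑ p, G.demand i * Real.exp (Y ⟨i, p⟩) / ∑ q, Real.exp (Y ⟨i, q⟩) = G.demand i
  rw [← Finset.sum_div, ← Finset.mul_sum, mul_div_assoc, div_self (G.sum_exp_pos Y i).ne', mul_one]

instance : Nonempty G.feasible := ⟨⟨G.logit 0, G.logit_mem_feasible 0⟩⟩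

theorem log_logit (Y : G.Route → ℝ) (r : G.Route) :
    Real.log (G.logit Y r) = Real.log (G.demand r.1) + Y r -
      Real.log (∑ q : {p : List E // p ∈ G.paths r.1}, Real.exp (Y ⟨r.1, q⟩)) := by
  rw [logit, Real.log_div (mul_pos (G.demand_pos _) (Real.exp_pos _)).ne' (G.sum_exp_pos Y r.1).ne',
    Real.log_mul (G.demand_pos _).ne' (Real.exp_pos _).ne', Real.log_exp]

/-- The log-partition function of the logit map, which is a convex potential of that map. -/
def logPartition (Y : G.Route → ℝ) : ℝ :=
  ∑ i, G.demand i * Real.log (∑ q : {p : List E // p ∈ G.paths i}, Real.exp (Y ⟨i, q⟩))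

theorem logPartition_eq_add_dotProduct_add (a b : G.Route → ℝ) :
    G.logPartition b = G.logPartition a + G.logit a ⬝ᵥ (b - a) +
      ∑ r, G.logit a r * (Real.log (G.logit a r) - Real.log (G.logit b r)) := by
  have ha := sum_mul_fst_of_mem_feasible (G.logit_mem_feasible a) fun i =>
    Real.log (∑ q : {p : List E // p ∈ G.paths i}, Real.exp (a ⟨i, q⟩))
  have hb := sum_mul_fst_of_mem_feasible (G.logit_mem_feasible a) fun i =>
    Real.log (∑ q : {p : List E // p ∈ G.paths i}, Real.exp (b ⟨i, q⟩))
  rw [logPartition, logPartition, ← ha, ← hb, dotProduct, ← Finset.sum_add_distrib,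
    ← Finset.sum_add_distrib]
  refine Finset.sum_congr rfl fun r _ => ?_
  rw [log_logit, log_logit, Pi.sub_apply]
  ring

theorem logPartition_add_dotProduct_add_le [Nonempty I] (a b : G.Route → ℝ) :
    G.logPartition a + G.logit a ⬝ᵥ (b - a) +
      (∑ r, |G.logit a r - G.logit b r|) ^ 2 / (4 * G.totalDemand) ≤ G.logPartition b := by
  rw [G.logPartition_eq_add_dotProduct_add a b]
  gcongr
  rw [div_le_iff₀' (mul_pos four_pos G.totalDemand_pos)]
  exact sq_sum_abs_sub_le_four_mul_sum_mul_log _ (fun r _ => G.logit_pos a r)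
    (fun r _ => G.logit_pos b r) (sum_of_mem_feasible (G.logit_mem_feasible a))
    (sum_of_mem_feasible (G.logit_mem_feasible b))

theorem dotProduct_le_logPartition {f : G.Route → ℝ} (hf : f ∈ G.feasible) (Y : G.Route → ℝ) :
    Y ⬝ᵥ f ≤ G.logPartition Y := by
  rw [logPartition, ← sum_mul_fst_of_mem_feasible hf fun i =>
    Real.log (∑ q : {p : List E // p ∈ G.paths i}, Real.exp (Y ⟨i, q⟩)), dotProduct_comm]
  refine Finset.sum_le_sum fun r _ => mul_le_mul_of_nonneg_left ?_ (hf.1 r)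
  rw [Real.le_log_iff_exp_le (G.sum_exp_pos Y r.1)]
  exact Finset.single_le_sum (f := fun q => Real.exp (Y ⟨r.1, q⟩))
    (fun _ _ => (Real.exp_pos _).le) (Finset.mem_univ r.2)

theorem logPartition_zero : G.logPartition 0 = ∑ i, G.demand i * Real.log (G.paths i).card := by
  simp [logPartition]

theorem logPartition_zero_le_constC' [Nonempty I] : G.logPartition 0 ≤ G.constC' := by
  have hm := G.totalDemand_pos
  have hcard : ∀ i, (0 : ℝ) < (G.paths i).card := fun i =>
    zero_lt_one.trans_le (G.one_le_card_paths i)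
  have hjensen := strictConcaveOn_log_Ioi.concaveOn.le_map_sum (t := Finset.univ)
    (w := fun i => G.demand i / G.totalDemand) (p := fun i => ((G.paths i).card : ℝ))
    (fun i _ => (div_pos (G.demand_pos i) hm).le)
    (by rw [← Finset.sum_div]; exact div_self hm.ne') (fun i _ => hcard i)
  simp only [smul_eq_mul, div_mul_eq_mul_div, ← Finset.sum_div, ← logPartition_zero] at hjensen
  have hsum : 0 < ∑ i, G.demand i * ((G.paths i).card : ℝ) :=
    Finset.sum_pos (fun i _ => mul_pos (G.demand_pos i) (hcard i)) Finset.univ_nonempty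
  rw [constC', ← div_le_iff₀' hm]
  refine hjensen.trans (Real.log_le_log (div_pos hsum hm) ?_)
  gcongr
  exact G.sum_demand_mul_card_le

end Logit

section ScaledPartition

/-- The log-partition function, normalized to vanish at `0` and rescaled by the inverse learning
rate `s`. It is the energy function of the regret analysis. -/
def scaledPartition (s : ℝ) (Y : G.Route → ℝ) : ℝ :=
  s * (G.logPartition (s⁻¹ • Y) - G.logPartition 0)

theorem scaledPartition_add_dotProduct_add_le [Nonempty I] {s : ℝ} (hs : 0 < s)
    (Y Z : G.Route → ℝ) :
    G.scaledPartition s Y + G.logit (s⁻¹ • Y) ⬝ᵥ (Z - Y) +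
      s * (∑ r, |G.logit (s⁻¹ • Y) r - G.logit (s⁻¹ • Z) r|) ^ 2 / (4 * G.totalDemand) ≤
    G.scaledPartition s Z := by
  have h := mul_le_mul_of_nonneg_left
    (G.logPartition_add_dotProduct_add_le (s⁻¹ • Y) (s⁻¹ • Z)) hs.le
  rw [← smul_sub, dotProduct_smul, smul_eq_mul, mul_add, mul_add, mul_inv_cancel_left₀ hs.ne',
    mul_div_assoc'] at h
  rw [scaledPartition, scaledPartition, mul_sub, mul_sub]
  linarith

theorem scaledPartition_anti [Nonempty I] (Y : G.Route → ℝ) :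
    AntitoneOn (fun s => G.scaledPartition s Y) (Set.Ioi 0) := by
  intro s hs s' hs' hle
  have hm := G.totalDemand_pos
  have htangent := le_of_add_le_of_nonneg_left (G.scaledPartition_add_dotProduct_add_le hs
    ((s / s') • Y) Y) (by have := hs.out; positivity)
  have htangent_zero := le_of_add_le_of_nonneg_left
    (G.logPartition_add_dotProduct_add_le (s'⁻¹ • Y) 0) (by positivity)
  have hscale : s⁻¹ • (s / s') • Y = s'⁻¹ • Y := by
    rw [smul_smul, div_eq_mul_inv, inv_mul_cancel_left₀ hs.out.ne']
  have hdot : (s' - s) * (G.logit (s'⁻¹ • Y) ⬝ᵥ (s'⁻¹ • Y)) =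
      G.logit (s'⁻¹ • Y) ⬝ᵥ (Y - (s / s') • Y) := by
    rw [dotProduct_sub, dotProduct_smul, dotProduct_smul, smul_eq_mul, smul_eq_mul]
    have := hs'.out.ne'
    field_simp
  rw [scaledPartition, hscale] at htangent
  rw [zero_sub, dotProduct_neg] at htangent_zero
  simp only [scaledPartition] at htangent ⊢
  nlinarith [mul_le_mul_of_nonneg_left htangent_zero (sub_nonneg.2 hle)]

theorem dotProduct_sub_le_scaledPartition [Nonempty I] {s : ℝ} (hs : 0 < s) (Y : G.Route → ℝ)
    {f : G.Route → ℝ} (hf : f ∈ G.feasible) :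
    Y ⬝ᵥ f - s * G.constC' ≤ G.scaledPartition s Y := by
  have h := G.dotProduct_le_logPartition hf (s⁻¹ • Y)
  rw [smul_dotProduct, smul_eq_mul, inv_mul_le_iff₀ hs] at h
  rw [scaledPartition, mul_sub]
  linarith [mul_le_mul_of_nonneg_left G.logPartition_zero_le_constC' hs.le]

/-- One step of mirror-prox: the scores move along the costs `c`, and the flow is the logit response
to the prediction `c'` of these costs. -/
theorem scaledPartition_sub_add_le [Nonempty I] {s : ℝ} (hs : 0 < s) (Y c c' : G.Route → ℝ) :
    G.scaledPartition s (Y - c) + c ⬝ᵥ G.logit (s⁻¹ • (Y - c')) +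
      s * (∑ r, |G.logit (s⁻¹ • (Y - c')) r - G.logit (s⁻¹ • Y) r|) ^ 2 / (4 * G.totalDemand) ≤
    G.scaledPartition s Y + 4 * G.totalDemand * (√(s ^ 2 + ‖c - c'‖ ^ 2) - s) := by
  have hstep := G.scaledPartition_add_dotProduct_add_le hs (Y - c) (Y - c')
  have hprediction := G.scaledPartition_add_dotProduct_add_le hs (Y - c') Y
  have hmem := fun Z => G.logit_mem_feasible (s⁻¹ • Z)
  set y := G.logit (s⁻¹ • (Y - c'))
  set z := G.logit (s⁻¹ • (Y - c))
  have hholder := (abs_le.1 (abs_dotProduct_le_norm_mul_sum_abs (c - c') (z - y))).1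
  have hscalar := mul_sub_mul_sq_div_le_sqrt_sub hs (norm_nonneg (c - c'))
    (sum_abs_sub_le_of_mem_feasible (hmem (Y - c)) (hmem (Y - c'))) G.totalDemand_pos
  simp only [Pi.sub_apply] at hholder
  rw [sub_sub_sub_cancel_left] at hstep
  rw [sub_sub_cancel] at hprediction
  rw [dotProduct_comm z] at hstep
  rw [dotProduct_comm y] at hprediction
  simp only [sub_dotProduct, dotProduct_sub] at hholder hstep
  linarith

end ScaledPartition

end CongestionGame

namespace CongestionGame

variable {V E I Ω : Type*} [Fintype I] [MeasurableSpace Ω] (G : CongestionGame V E I Ω)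

section Cost

theorem nodup_of_route (r : G.Route) : r.2.1.Nodup :=
  List.Nodup.of_map _ (G.isPath r.1 r.2.1 r.2.2).2.of_append_left

variable {G} in
theorem load_mem_Icc {f : G.Route → ℝ} (hf : f ∈ G.feasible) (e : E) :
    G.load f e ∈ Set.Icc 0 (∑ i, G.demand i) := by
  constructor
  · exact Finset.sum_nonneg fun r _ => by split_ifs; exacts [hf.1 r, le_rfl]
  · rw [← totalDemand, ← sum_of_mem_feasible hf]
    exact Finset.sum_le_sum fun r _ => by split_ifs; exacts [le_rfl, hf.1 r]

open scoped Classical in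
theorem load_sub (f g : G.Route → ℝ) (e : E) :
    G.load g e - G.load f e = ∑ r : G.Route, if e ∈ r.2.1 then g r - f r else 0 := by
  rw [load, load, ← Finset.sum_sub_distrib]
  exact Finset.sum_congr rfl fun r _ => by split_ifs <;> simp only [sub_zero]

theorem continuous_load (e : E) : Continuous fun f => G.load f e :=
  continuous_finsetSum _ fun r _ => by split_ifs <;> fun_prop

open scoped Classical in
theorem pathCost_eq_sum (f : G.Route → ℝ) (s : Ω) (r : G.Route) :
    G.pathCost f s r = ∑ e ∈ r.2.1.toFinset, G.cost e (G.load f e) s :=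
  (List.sum_toFinset _ (G.nodup_of_route r)).symm

theorem integrable_cost (e : E) {x : ℝ} (hx : x ∈ Set.Icc 0 (∑ i, G.demand i)) :
    Integrable (G.cost e x) G.law := by
  obtain ⟨H, hH⟩ := G.cost_bounded
  refine Integrable.of_bound (G.cost_measurable e x hx).aestronglyMeasurable H
    (Filter.Eventually.of_forall fun s => ?_)
  rw [Real.norm_of_nonneg (G.cost_nonneg e s x hx)]
  exact hH e s x hx

theorem monotoneOn_meanCost (e : E) :
    MonotoneOn (G.meanCost e) (Set.Icc 0 (∑ i, G.demand i)) := fun _ hx _ hy hxy =>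
  integral_mono (G.integrable_cost e hx) (G.integrable_cost e hy) fun s =>
    G.cost_monotone e s hx hy hxy

theorem exists_norm_pathCost_le : ∃ B, ∀ f ∈ G.feasible, ∀ s, ‖G.pathCost f s‖ ≤ B := by
  classical
  obtain ⟨H, hH⟩ := G.cost_bounded
  refine ⟨∑ r : G.Route, r.2.1.toFinset.card * |H|, fun f hf s =>
    (pi_norm_le_iff_of_nonneg (by positivity)).2 fun r => ?_⟩
  calc ‖G.pathCost f s r‖ ≤ ∑ e ∈ r.2.1.toFinset, ‖G.cost e (G.load f e) s‖ := by
        rw [pathCost_eq_sum]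
        exact norm_sum_le _ _
    _ ≤ ∑ _e ∈ r.2.1.toFinset, |H| := Finset.sum_le_sum fun e _ => by
        rw [Real.norm_of_nonneg (G.cost_nonneg e s _ (load_mem_Icc hf e))]
        exact (hH e s _ (load_mem_Icc hf e)).trans (le_abs_self H)
    _ = r.2.1.toFinset.card * |H| := by rw [Finset.sum_const, nsmul_eq_mul]
    _ ≤ _ := Finset.single_le_sum (f := fun r : G.Route => (r.2.1.toFinset.card * |H| : ℝ))
        (fun _ _ => by positivity) (Finset.mem_univ r)

theorem measurable_pathCost : Measurable fun p : G.feasible × Ω => G.pathCost p.1 p.2 := by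
  classical
  refine measurable_pi_iff.2 fun r => ?_
  simp only [pathCost_eq_sum]
  refine Finset.measurable_fun_sum _ fun e _ => ?_
  refine measurable_uncurry_of_continuous_of_measurable
    (u := fun (f : G.feasible) s => G.cost e (G.load f e) s) (fun s => ?_)
    fun f => G.cost_measurable e _ (load_mem_Icc f.2 e)
  obtain ⟨K, hK⟩ := G.cost_lipschitz
  exact (hK e s).continuousOn.comp_continuous
    ((G.continuous_load e).comp continuous_subtype_val) fun f => load_mem_Icc f.2 e

theorem integrable_pathCost {f : G.Route → ℝ} (hf : f ∈ G.feasible) :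
    Integrable (G.pathCost f) G.law := by
  obtain ⟨B, hB⟩ := G.exists_norm_pathCost_le
  have hmeas : Measurable (G.pathCost f) :=
    G.measurable_pathCost.comp (measurable_prodMk_left (x := (⟨f, hf⟩ : G.feasible)))
  exact Integrable.of_bound hmeas.aestronglyMeasurable B (Filter.Eventually.of_forall (hB f hf))

theorem meanPathCost_eq_integral {f : G.Route → ℝ} (hf : f ∈ G.feasible) :
    G.meanPathCost f = ∫ s, G.pathCost f s ∂G.law :=
  funext fun r => (eval_integral (Integrable.eval (G.integrable_pathCost hf)) r).symm

theorem norm_meanPathCost_le {f : G.Route → ℝ} (hf : f ∈ G.feasible) {B : ℝ}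
    (hB : ∀ s, ‖G.pathCost f s‖ ≤ B) : ‖G.meanPathCost f‖ ≤ B := by
  rw [G.meanPathCost_eq_integral hf]
  simpa only [probReal_univ, mul_one] using
    norm_integral_le_of_norm_le_const (μ := G.law) (Filter.Eventually.of_forall hB)

theorem measurable_meanPathCost : Measurable fun f : G.feasible => G.meanPathCost f :=
  measurable_pi_iff.2 fun r => (((measurable_pi_apply r).comp
    G.measurable_pathCost).stronglyMeasurable.integral_prod_right' (ν := G.law)).measurable

end Cost

section Potential

open scoped Classical in
theorem meanPathCost_eq_sum {f : G.Route → ℝ} (hf : f ∈ G.feasible) (r : G.Route) :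
    G.meanPathCost f r = ∑ e ∈ r.2.1.toFinset, G.meanCost e (G.load f e) := by
  simp only [meanPathCost, pathCost_eq_sum]
  exact integral_finsetSum _ fun e _ => G.integrable_cost e (load_mem_Icc hf e)

variable [Fintype E] {f g : G.Route → ℝ}

theorem meanPathCost_dotProduct_sub (hf : f ∈ G.feasible) (g : G.Route → ℝ) :
    G.meanPathCost f ⬝ᵥ (g - f) =
      ∑ e, G.meanCost e (G.load f e) * (G.load g e - G.load f e) := by
  classical
  simp only [dotProduct, Pi.sub_apply, G.meanPathCost_eq_sum hf, load_sub, Finset.sum_mul,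
    Finset.mul_sum, mul_ite, mul_zero]
  rw [Finset.sum_comm]
  refine Finset.sum_congr rfl fun r _ => ?_
  simp only [← List.mem_toFinset, Finset.sum_ite_mem, Finset.univ_inter]

theorem potential_add_dotProduct_le (hf : f ∈ G.feasible) (hg : g ∈ G.feasible) :
    G.potential f + G.meanPathCost f ⬝ᵥ (g - f) ≤ G.potential g := by
  rw [G.meanPathCost_dotProduct_sub hf, potential, potential, ← Finset.sum_add_distrib]
  refine Finset.sum_le_sum fun e _ => ?_
  have hx := load_mem_Icc hf e
  have hy := load_mem_Icc hg e
  have hmono : ∀ {a b}, a ∈ Set.Icc 0 (∑ i, G.demand i) → b ∈ Set.Icc 0 (∑ i, G.demand i) →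
      MonotoneOn (G.meanCost e) (Set.uIcc a b) := fun ha hb =>
    (G.monotoneOn_meanCost e).mono (Set.uIcc_subset_Icc ha hb)
  rw [← intervalIntegral.integral_add_adjacent_intervals
    (hmono ⟨le_rfl, hx.1.trans hx.2⟩ hx).intervalIntegrable (hmono hx hy).intervalIntegrable]
  gcongr
  exact mul_sub_le_integral_of_monotoneOn (hmono hx hy)

theorem abs_potential_sub_le (hf : f ∈ G.feasible) (hg : g ∈ G.feasible) {B : ℝ}
    (hB : ∀ h ∈ G.feasible, ∀ s, ‖G.pathCost h s‖ ≤ B) :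
    |G.potential f - G.potential g| ≤ B * ∑ r, |f r - g r| := by
  have hbound : ∀ {h h'}, h ∈ G.feasible → h' ∈ G.feasible →
      G.potential h - G.potential h' ≤ B * ∑ r, |h' r - h r| := fun {h h'} hh hh' => by
    have hholder := (abs_dotProduct_le_norm_mul_sum_abs (G.meanPathCost h) (h' - h)).trans
      (mul_le_mul_of_nonneg_right (G.norm_meanPathCost_le hh (hB h hh))
        (Finset.sum_nonneg fun r _ => abs_nonneg _))
    simp only [Pi.sub_apply] at hholder
    linarith [(abs_le.1 hholder).1, G.potential_add_dotProduct_le hh hh']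
  have hfg := hbound hf hg
  simp only [abs_sub_comm (g _)] at hfg
  exact abs_sub_le_iff.2 ⟨hfg, hbound hg hf⟩

theorem exists_abs_potential_sub_le :
    ∃ B, ∀ f ∈ G.feasible, ∀ g ∈ G.feasible, |G.potential f - G.potential g| ≤ B := by
  obtain ⟨B, hB⟩ := G.exists_norm_pathCost_le
  have hB0 : 0 ≤ B := (norm_nonneg (G.pathCost _ _)).trans
    (hB _ (G.logit_mem_feasible 0) (nonempty_of_isProbabilityMeasure G.law).some)
  exact ⟨B * (2 * G.totalDemand), fun f hf g hg => (G.abs_potential_sub_le hf hg hB).trans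
    (mul_le_mul_of_nonneg_left (sum_abs_sub_le_of_mem_feasible hf hg) hB0)⟩

theorem continuousOn_potential : ContinuousOn G.potential G.feasible := by
  obtain ⟨B, hB⟩ := G.exists_norm_pathCost_le
  intro f hf
  have hcont : Continuous fun g : G.Route → ℝ => B * ∑ r, |g r - f r| := by fun_prop
  have hlim := (hcont.tendsto f).mono_left (nhdsWithin_le_nhds (s := G.feasible))
  simp only [sub_self, abs_zero, Finset.sum_const_zero, mul_zero] at hlim
  exact tendsto_iff_dist_tendsto_zero.2 (squeeze_zero' (Filter.Eventually.of_forall fun _ =>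
    dist_nonneg) (eventually_mem_nhdsWithin.mono fun g hg => G.abs_potential_sub_le hg hf hB) hlim)

theorem sub_sInf_potential_le {a b : ℝ} (hb : ∀ g ∈ G.feasible, a - G.potential g ≤ b) :
    a - sInf (G.potential '' G.feasible) ≤ b := by
  refine sub_le_comm.1 (le_csInf (Set.Nonempty.image _ ⟨_, G.logit_mem_feasible 0⟩) ?_)
  rintro _ ⟨g, hg, rfl⟩
  exact sub_le_comm.1 (hb g hg)

end Potential

section Noise

/-- The noise in the path costs under the flow `f`: their deviation from the mean. -/
def costNoise (f : G.Route → ℝ) (s : Ω) : G.Route → ℝ := G.pathCost f s - G.meanPathCost f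

theorem measurable_costNoise : Measurable fun p : G.feasible × Ω => G.costNoise p.1 p.2 :=
  G.measurable_pathCost.sub (G.measurable_meanPathCost.comp measurable_fst)

theorem exists_norm_costNoise_le : ∃ B, ∀ f ∈ G.feasible, ∀ s, ‖G.costNoise f s‖ ≤ B := by
  obtain ⟨B, hB⟩ := G.exists_norm_pathCost_le
  exact ⟨B + B, fun f hf s => (norm_sub_le _ _).trans
    (add_le_add (hB f hf s) (G.norm_meanPathCost_le hf (hB f hf)))⟩

theorem noiseLevel_nonneg : 0 ≤ G.noiseLevel := Real.sqrt_nonneg _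

variable {f : G.Route → ℝ}

theorem integral_costNoise_dotProduct (hf : f ∈ G.feasible) (v : G.Route → ℝ) :
    ∫ s, G.costNoise f s ⬝ᵥ v ∂G.law = 0 := by
  have hint := fun r => (G.integrable_pathCost hf).eval r
  have hnoise : ∀ r, Integrable (fun s => (G.pathCost f s r - G.meanPathCost f r) * v r) G.law :=
    fun r => ((hint r).sub (integrable_const _)).mul_const _
  simp only [dotProduct, costNoise, Pi.sub_apply]
  rw [integral_finsetSum _ fun r _ => hnoise r]
  refine Finset.sum_eq_zero fun r _ => ?_
  rw [integral_mul_const, integral_sub (hint r) (integrable_const _), integral_const,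
    probReal_univ, one_smul, meanPathCost, sub_self, zero_mul]

theorem integral_sq_norm_costNoise_le (hf : f ∈ G.feasible) :
    ∫ s, ‖G.costNoise f s‖ ^ 2 ∂G.law ≤ G.noiseLevel ^ 2 := by
  obtain ⟨B, hB⟩ := G.exists_norm_costNoise_le
  have hbdd : BddAbove (Set.range fun g : G.feasible => ∫ s, ‖G.costNoise g s‖ ^ 2 ∂G.law) := by
    refine ⟨B ^ 2, ?_⟩
    rintro _ ⟨g, rfl⟩
    refine (Real.le_norm_self _).trans ?_
    simpa only [probReal_univ, mul_one] using norm_integral_le_of_norm_le_const (μ := G.law)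
      (Filter.Eventually.of_forall fun s => by
        rw [norm_pow, norm_norm]
        exact pow_le_pow_left₀ (norm_nonneg _) (hB g g.2 s) 2)
  rw [noiseLevel, Real.sq_sqrt (Real.iSup_nonneg fun g => integral_nonneg fun s => sq_nonneg _)]
  exact le_ciSup hbdd ⟨f, hf⟩

end Noise

end CongestionGame

/-- Step weights of the epochs `1, 2, …`. There is no epoch `0`, hence its weight vanishes. -/
structure IsStepWeight (α : ℕ → ℝ) : Prop where
  zero : α 0 = 0
  pos : ∀ n, 0 < α (n + 1)

/-- `A_n`, the total weight of the epochs `1, …, n`. -/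
def weightSum (α : ℕ → ℝ) (n : ℕ) : ℝ := ∑ s ∈ Finset.range (n + 1), α s

theorem weightSum_succ (α : ℕ → ℝ) (n : ℕ) : weightSum α (n + 1) = weightSum α n + α (n + 1) :=
  Finset.sum_range_succ α (n + 1)

namespace IsStepWeight

variable {α : ℕ → ℝ} (hα : IsStepWeight α)
include hα

theorem weightSum_eq_sum (n : ℕ) : weightSum α n = ∑ k ∈ Finset.range n, α (k + 1) := by
  rw [weightSum, Finset.sum_range_succ', hα.zero, add_zero]

theorem weightSum_nonneg (n : ℕ) : 0 ≤ weightSum α n := by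
  rw [hα.weightSum_eq_sum]
  exact Finset.sum_nonneg fun k _ => (hα.pos k).le

theorem weightSum_succ_pos (n : ℕ) : 0 < weightSum α (n + 1) := by
  rw [weightSum_succ]
  exact add_pos_of_nonneg_of_pos (hα.weightSum_nonneg n) (hα.pos n)

end IsStepWeight

namespace CongestionGame

variable {V E I Ω : Type*} [Fintype I] [MeasurableSpace Ω] {G : CongestionGame V E I Ω}

namespace Memory

/-- The inverse of the learning rate. -/
def scale (m : G.Memory) : ℝ := √(1 + m.sqSum)

theorem rate_eq_inv_scale (m : G.Memory) : m.rate = m.scale⁻¹ := one_div _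

section Average

variable {m : G.Memory} {α : ℕ → ℝ} (hα : IsStepWeight α) {n : ℕ}
include hα

theorem weightSum_smul_average (y : G.Route → ℝ) :
    weightSum α (n + 1) • m.average α (n + 1) y = α (n + 1) • y + m.anchor :=
  smul_inv_smul₀ (hα.weightSum_succ_pos n).ne' _

theorem average_mem_feasible (hm : ∃ x ∈ G.feasible, m.anchor = weightSum α n • x)
    {y : G.Route → ℝ} (hy : y ∈ G.feasible) : m.average α (n + 1) y ∈ G.feasible := by
  obtain ⟨x, hx, hanchor⟩ := hm
  have hA := hα.weightSum_succ_pos n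
  have h := convex_feasible hy hx (div_nonneg (hα.pos n).le hA.le)
    (div_nonneg (hα.weightSum_nonneg n) hA.le)
    (by rw [← add_div, add_comm, ← weightSum_succ, div_self hA.ne'])
  rwa [div_eq_inv_mul, div_eq_inv_mul, mul_smul, mul_smul, ← smul_add, ← hanchor] at h

theorem sum_abs_average_sub_average (y z : G.Route → ℝ) :
    weightSum α (n + 1) * ∑ r, |m.average α (n + 1) y r - m.average α (n + 1) z r| =
      α (n + 1) * ∑ r, |y r - z r| := by
  rw [Finset.mul_sum, Finset.mul_sum]
  refine Finset.sum_congr rfl fun r _ => ?_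
  have hy := congrFun (weightSum_smul_average (m := m) hα (n := n) y) r
  have hz := congrFun (weightSum_smul_average (m := m) hα (n := n) z) r
  simp only [Pi.smul_apply, Pi.add_apply, smul_eq_mul] at hy hz
  have hscaled : ∀ {c : ℝ}, 0 < c → ∀ a b : ℝ, c * |a - b| = |c * a - c * b| := fun hc a b => by
    rw [← mul_sub, abs_mul, abs_of_pos hc]
  rw [hscaled (hα.weightSum_succ_pos n), hscaled (hα.pos n), hy, hz, add_sub_add_right_eq_sub]

end Average

end Memory

variable (G) (α : ℕ → ℝ) (s : ℕ → Phase → Ω)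

/-- The flow that AdaWeight tests in epoch `t ≥ 1`. -/
def testedFlow (t : ℕ) : G.Route → ℝ := (G.memory α s (t - 1)).testFlow α t

/-- The flow `yᵗ` that AdaWeight adds to its anchor in epoch `t ≥ 1`. -/
def leadingFlow (t : ℕ) : G.Route → ℝ := (G.memory α s (t - 1)).leadFlow α t (s t Phase.test)

/-- The `ℓ¹` distance by which the observed test costs move the logit flow in epoch `t ≥ 1`. -/
def leadDist (t : ℕ) : ℝ :=
  ∑ r, |G.leadingFlow α s t r -
    G.logit ((G.memory α s (t - 1)).rate • (G.memory α s (t - 1)).score) r|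

/-- The weighted path costs incurred in epoch `t` minus those predicted by its test phase. -/
def predictionError (t : ℕ) : G.Route → ℝ :=
  α t • (G.pathCost (G.adaWeight α s t) (s t Phase.recommend) -
    G.pathCost (G.testedFlow α s t) (s t Phase.test))

section Memory

theorem anchor_memory (n : ℕ) : (G.memory α s n).anchor =
    ∑ k ∈ Finset.range n, α (k + 1) • G.leadingFlow α s (k + 1) := by
  induction n with
  | zero => rfl
  | succ n ih => rw [Finset.sum_range_succ, ← ih]; rfl

theorem score_memory (n : ℕ) : (G.memory α s n).score =
    -∑ k ∈ Finset.range n,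
      α (k + 1) • G.pathCost (G.adaWeight α s (k + 1)) (s (k + 1) Phase.recommend) := by
  induction n with
  | zero => exact neg_zero.symm
  | succ n ih => rw [Finset.sum_range_succ, neg_add, ← ih, ← sub_eq_add_neg]; rfl

theorem sqSum_memory (n : ℕ) : (G.memory α s n).sqSum =
    ∑ k ∈ Finset.range n, ‖G.predictionError α s (k + 1)‖ ^ 2 := by
  induction n with
  | zero => rfl
  | succ n ih => rw [Finset.sum_range_succ, ← ih]; rfl

theorem one_le_one_add_sqSum_memory (n : ℕ) : 1 ≤ 1 + (G.memory α s n).sqSum := by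
  rw [sqSum_memory]
  exact le_add_of_nonneg_right (Finset.sum_nonneg fun k _ => sq_nonneg _)

theorem sq_scale_memory (n : ℕ) :
    (G.memory α s n).scale ^ 2 = 1 + (G.memory α s n).sqSum :=
  Real.sq_sqrt (zero_le_one.trans (G.one_le_one_add_sqSum_memory α s n))

theorem one_le_scale_memory (n : ℕ) : 1 ≤ (G.memory α s n).scale :=
  Real.one_le_sqrt.2 (G.one_le_one_add_sqSum_memory α s n)

theorem scale_memory_succ (n : ℕ) : (G.memory α s (n + 1)).scale =
    √((G.memory α s n).scale ^ 2 + ‖G.predictionError α s (n + 1)‖ ^ 2) := by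
  rw [sq_scale_memory, add_assoc]
  rfl

end Memory

section Feasible

theorem leadingFlow_mem_feasible (t : ℕ) : G.leadingFlow α s t ∈ G.feasible :=
  G.logit_mem_feasible _

variable {α} (hα : IsStepWeight α)
include hα

theorem exists_anchor_memory_eq (n : ℕ) :
    ∃ x ∈ G.feasible, (G.memory α s n).anchor = weightSum α n • x := by
  induction n with
  | zero => exact ⟨_, G.logit_mem_feasible 0, by simp [hα.weightSum_eq_sum, memory]⟩
  | succ n ih =>
    exact ⟨G.adaWeight α s (n + 1),
      Memory.average_mem_feasible hα ih (G.logit_mem_feasible _),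
      (add_comm _ _).trans (Memory.weightSum_smul_average hα _).symm⟩

theorem adaWeight_mem_feasible (n : ℕ) : G.adaWeight α s (n + 1) ∈ G.feasible :=
  Memory.average_mem_feasible hα (G.exists_anchor_memory_eq s hα n) (G.logit_mem_feasible _)

theorem testedFlow_mem_feasible (n : ℕ) : G.testedFlow α s (n + 1) ∈ G.feasible :=
  Memory.average_mem_feasible hα (G.exists_anchor_memory_eq s hα n) (G.logit_mem_feasible _)

theorem sum_smul_adaWeight (n : ℕ) :
    (∑ k ∈ Finset.range (n + 1), α (k + 1)) • G.adaWeight α s (n + 1) =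
      ∑ k ∈ Finset.range (n + 1), α (k + 1) • G.leadingFlow α s (k + 1) := by
  rw [← hα.weightSum_eq_sum, ← anchor_memory]
  exact (Memory.weightSum_smul_average hα _).trans (add_comm _ _)

theorem sum_abs_adaWeight_sub_testedFlow (n : ℕ) :
    weightSum α (n + 1) * ∑ r, |G.adaWeight α s (n + 1) r - G.testedFlow α s (n + 1) r| =
      α (n + 1) * G.leadDist α s (n + 1) :=
  Memory.sum_abs_average_sub_average hα _ _

end Feasible

section Regret

theorem leadDist_nonneg (t : ℕ) : 0 ≤ G.leadDist α s t :=
  Finset.sum_nonneg fun _ _ => abs_nonneg _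

theorem leadDist_le (t : ℕ) : G.leadDist α s t ≤ 2 * G.totalDemand :=
  sum_abs_sub_le_of_mem_feasible (G.leadingFlow_mem_feasible α s t) (G.logit_mem_feasible _)

variable [Nonempty I]

theorem scaledPartition_memory_succ_le (n : ℕ) :
    G.scaledPartition (G.memory α s (n + 1)).scale (G.memory α s (n + 1)).score +
        α (n + 1) * (G.pathCost (G.adaWeight α s (n + 1)) (s (n + 1) Phase.recommend) ⬝ᵥ
          G.leadingFlow α s (n + 1)) +
        (G.memory α s n).scale * G.leadDist α s (n + 1) ^ 2 / (4 * G.totalDemand) ≤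
      G.scaledPartition (G.memory α s n).scale (G.memory α s n).score +
        4 * G.totalDemand * ((G.memory α s (n + 1)).scale - (G.memory α s n).scale) := by
  have hscale := one_pos.trans_le (G.one_le_scale_memory α s n)
  have hscale_succ := one_pos.trans_le (G.one_le_scale_memory α s (n + 1))
  have hmono : (G.memory α s n).scale ≤ (G.memory α s (n + 1)).scale := by
    rw [scale_memory_succ]
    exact Real.le_sqrt_of_sq_le (le_add_of_nonneg_right (sq_nonneg _))
  have hanti := G.scaledPartition_anti (G.memory α s (n + 1)).score hscale hscale_succ hmono
  have hstep := G.scaledPartition_sub_add_le hscale (G.memory α s n).score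
    (α (n + 1) • G.pathCost (G.adaWeight α s (n + 1)) (s (n + 1) Phase.recommend))
    (α (n + 1) • G.pathCost (G.testedFlow α s (n + 1)) (s (n + 1) Phase.test))
  rw [← smul_sub, ← predictionError, ← scale_memory_succ, ← Memory.rate_eq_inv_scale,
    smul_dotProduct, smul_eq_mul] at hstep
  exact (add_le_add_left (add_le_add_left hanti _) _).trans hstep

theorem scaledPartition_memory_add_sum_le (n : ℕ) :
    G.scaledPartition (G.memory α s n).scale (G.memory α s n).score +
        ∑ k ∈ Finset.range n, (α (k + 1) *
          (G.pathCost (G.adaWeight α s (k + 1)) (s (k + 1) Phase.recommend) ⬝ᵥ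
            G.leadingFlow α s (k + 1)) +
          (G.memory α s k).scale * G.leadDist α s (k + 1) ^ 2 / (4 * G.totalDemand)) ≤
      4 * G.totalDemand * ((G.memory α s n).scale - 1) := by
  induction n with
  | zero => simp [memory, Memory.scale, scaledPartition]
  | succ n ih =>
    rw [Finset.sum_range_succ]
    linarith [G.scaledPartition_memory_succ_le α s n]

theorem regret_add_sum_leadDist_le {f : G.Route → ℝ} (hf : f ∈ G.feasible) (n : ℕ) :
    ∑ k ∈ Finset.range n, α (k + 1) *
        (G.pathCost (G.adaWeight α s (k + 1)) (s (k + 1) Phase.recommend) ⬝ᵥ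
          (G.leadingFlow α s (k + 1) - f)) +
        ∑ k ∈ Finset.range n,
          (G.memory α s k).scale * G.leadDist α s (k + 1) ^ 2 / (4 * G.totalDemand) ≤
      G.constC' + G.constC / 2 * ((G.memory α s n).scale - 1) := by
  have hscale := G.one_le_scale_memory α s n
  have hlower := G.dotProduct_sub_le_scaledPartition (one_pos.trans_le hscale)
    (G.memory α s n).score hf
  have hupper := G.scaledPartition_memory_add_sum_le α s n
  rw [score_memory, neg_dotProduct, sum_dotProduct, ← score_memory] at hlower
  simp only [smul_dotProduct, smul_eq_mul] at hlower
  rw [Finset.sum_add_distrib] at hupper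
  simp only [dotProduct_sub, mul_sub, Finset.sum_sub_distrib]
  nlinarith [mul_le_mul_of_nonneg_right G.two_mul_constC'_add_le_constC (sub_nonneg.2 hscale),
    mul_nonneg G.totalDemand_nonneg (sub_nonneg.2 hscale)]

end Regret

section Noise

/-- The noise in the path costs observed in the recommendation phase of epoch `t`. -/
def recommendNoise (t : ℕ) : G.Route → ℝ := G.costNoise (G.adaWeight α s t) (s t Phase.recommend)

/-- The noise in the path costs observed in the test phase of epoch `t`. -/
def testNoise (t : ℕ) : G.Route → ℝ := G.costNoise (G.testedFlow α s t) (s t Phase.test)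

/-- The weighted squared noise of the epochs `1, …, n`. It controls the loss of regret due to
the noise in the predictions. -/
def noiseEnergy (n : ℕ) : ℝ :=
  ∑ k ∈ Finset.range n,
    α (k + 1) ^ 2 * (‖G.recommendNoise α s (k + 1)‖ ^ 2 + ‖G.testNoise α s (k + 1)‖ ^ 2)

/-- The difference between the regrets of the epochs `1, …, n` against `f` for the observed path
costs and for the mean path costs. -/
def noiseRegret (f : G.Route → ℝ) (n : ℕ) : ℝ :=
  ∑ k ∈ Finset.range n,
    α (k + 1) * (G.recommendNoise α s (k + 1) ⬝ᵥ (G.leadingFlow α s (k + 1) - f))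

theorem noiseEnergy_nonneg (n : ℕ) : 0 ≤ G.noiseEnergy α s n :=
  Finset.sum_nonneg fun _ _ => by positivity

variable {α} (hα : IsStepWeight α) {L : ℝ} (hL : 0 ≤ L) (hG : G.IsSmoothWith L)
  (hsq : ∀ n, α n ^ 2 ≤ 2 * weightSum α n)

include hα in
theorem weightSum_mul_potential_sub_add_noiseRegret_le_regret [Fintype E] {f : G.Route → ℝ}
    (hf : f ∈ G.feasible) (n : ℕ) :
    weightSum α (n + 1) * (G.potential (G.adaWeight α s (n + 1)) - G.potential f) +
        G.noiseRegret α s f (n + 1) ≤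
      ∑ k ∈ Finset.range (n + 1), α (k + 1) *
        (G.pathCost (G.adaWeight α s (k + 1)) (s (k + 1) Phase.recommend) ⬝ᵥ
          (G.leadingFlow α s (k + 1) - f)) := by
  have h := sum_mul_sub_le_sum_mul_dotProduct
    (fun x hx z hz => G.potential_add_dotProduct_le hx hz) (fun k => (hα.pos k).le)
    (G.adaWeight_mem_feasible s hα) (G.sum_smul_adaWeight s hα) hf n
  rw [← hα.weightSum_eq_sum] at h
  refine (add_le_add_left h _).trans_eq ?_
  rw [noiseRegret, ← Finset.sum_add_distrib]
  refine Finset.sum_congr rfl fun k _ => ?_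
  rw [recommendNoise, costNoise, ← mul_add, ← add_dotProduct, add_sub_cancel]

include hα hL hG hsq in
theorem norm_predictionError_le (n : ℕ) : ‖G.predictionError α s (n + 1)‖ ≤
    2 * L * G.leadDist α s (n + 1) +
      α (n + 1) * (‖G.recommendNoise α s (n + 1)‖ + ‖G.testNoise α s (n + 1)‖) := by
  set x := G.adaWeight α s (n + 1) with hx
  set x' := G.testedFlow α s (n + 1) with hx'
  have hαpos := hα.pos n
  have hA := hα.weightSum_succ_pos n
  have hdist : α (n + 1) * ∑ r, |x r - x' r| ≤ 2 * G.leadDist α s (n + 1) := by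
    refine le_of_mul_le_mul_left ?_ hA
    rw [mul_left_comm, G.sum_abs_adaWeight_sub_testedFlow s hα, ← mul_assoc, ← sq]
    exact (mul_le_mul_of_nonneg_right (hsq (n + 1)) (G.leadDist_nonneg α s (n + 1))).trans_eq
      (by ring)
  have hmean := hG _ (G.adaWeight_mem_feasible s hα n) _ (G.testedFlow_mem_feasible s hα n)
  have hsplit : G.pathCost x (s (n + 1) Phase.recommend) - G.pathCost x' (s (n + 1) Phase.test) =
      (G.meanPathCost x - G.meanPathCost x') +
        (G.recommendNoise α s (n + 1) - G.testNoise α s (n + 1)) := by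
    rw [recommendNoise, testNoise, costNoise, costNoise]
    abel
  calc ‖G.predictionError α s (n + 1)‖
      = α (n + 1) * ‖(G.meanPathCost x - G.meanPathCost x') +
          (G.recommendNoise α s (n + 1) - G.testNoise α s (n + 1))‖ := by
        rw [predictionError, norm_smul, Real.norm_of_nonneg hαpos.le, ← hx, ← hx', hsplit]
    _ ≤ α (n + 1) * (L * ∑ r, |x r - x' r| +
          (‖G.recommendNoise α s (n + 1)‖ + ‖G.testNoise α s (n + 1)‖)) := by
        gcongr
        exact (norm_add_le _ _).trans (add_le_add hmean (norm_sub_le _ _))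
    _ ≤ _ := by linarith [mul_le_mul_of_nonneg_left hdist hL]

theorem sum_sq_mul_norm_add_norm_le (n : ℕ) :
    ∑ k ∈ Finset.range n,
        (α (k + 1) * (‖G.recommendNoise α s (k + 1)‖ + ‖G.testNoise α s (k + 1)‖)) ^ 2 ≤
      2 * G.noiseEnergy α s n := by
  rw [noiseEnergy, Finset.mul_sum]
  refine Finset.sum_le_sum fun k _ => ?_
  rw [mul_pow, mul_left_comm]
  exact mul_le_mul_of_nonneg_left (add_sq_le ..) (sq_nonneg _)

variable [Nonempty I]

include hL in
/-- The left side is the bound of `mul_sqrt_one_add_sum_sub_one_sub_sum_le` for the parameters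
`C / 2`, `1 / (4 ‖m‖₁)` and `2 ‖m‖₁`. -/
theorem half_constC_mul_sqrt_le :
    G.constC / 2 * √(8 * L ^ 2 * (G.constC / 2 / (2 * (1 / (4 * G.totalDemand))) +
      (2 * G.totalDemand) ^ 2)) ≤
    8 * L * √(Fintype.card I * G.maxDemand) * G.constC ^ (3 / 2 : ℝ) := by
  have hm := G.totalDemand_pos
  have hC := G.constC_pos
  set κ : ℝ := Fintype.card I * G.maxDemand
  have hmκ : G.totalDemand ≤ κ := G.totalDemand_le
  have hκC : κ ≤ G.constC := G.card_mul_maxDemand_le_constC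
  have hκ_nonneg := hm.le.trans hmκ
  have hfrac : G.constC / 2 / (2 * (1 / (4 * G.totalDemand))) = G.totalDemand * G.constC := by
    field_simp
    ring
  have hsum : G.totalDemand * G.constC + (2 * G.totalDemand) ^ 2 ≤ 32 * (κ * G.constC) := by
    nlinarith [mul_le_mul_of_nonneg_right hmκ hC.le, mul_le_mul hmκ (hmκ.trans hκC) hm.le hκ_nonneg,
      mul_nonneg hκ_nonneg hC.le]
  calc G.constC / 2 * √(8 * L ^ 2 * (G.constC / 2 / (2 * (1 / (4 * G.totalDemand))) +
        (2 * G.totalDemand) ^ 2))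
      ≤ G.constC / 2 * √((16 * L) ^ 2 * (κ * G.constC)) := by
        rw [hfrac]
        refine mul_le_mul_of_nonneg_left (Real.sqrt_le_sqrt ?_) (half_pos hC).le
        linarith [mul_le_mul_of_nonneg_left hsum (sq_nonneg L)]
    _ = _ := by
        rw [Real.sqrt_mul (sq_nonneg _), Real.sqrt_sq (by positivity), Real.sqrt_mul hκ_nonneg,
          rpow_three_halves hC.le]
        ring

include hα hL hG hsq in
theorem weightSum_mul_potential_sub_add_noiseRegret_le [Fintype E] {f : G.Route → ℝ}
    (hf : f ∈ G.feasible) (n : ℕ) :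
    weightSum α (n + 1) * (G.potential (G.adaWeight α s (n + 1)) - G.potential f) +
        G.noiseRegret α s f (n + 1) ≤
      G.constC' + G.constC * √(G.noiseEnergy α s (n + 1)) +
        8 * L * √(Fintype.card I * G.maxDemand) * G.constC ^ (3 / 2 : ℝ) := by
  have hC := G.constC_pos
  have hadaptive := mul_sqrt_one_add_sum_sub_one_sub_sum_le (half_pos hC).le
    (one_div_pos.2 (mul_pos four_pos G.totalDemand_pos))
    (fun k => norm_nonneg (G.predictionError α s (k + 1)))
    (fun k => G.leadDist_nonneg α s (k + 1)) (fun k => G.leadDist_le α s (k + 1))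
    (G.norm_predictionError_le s hα hL hG hsq) (n + 1)
  have hquad : ∀ k, 1 / (4 * G.totalDemand) * √(1 + (G.memory α s k).sqSum) *
      G.leadDist α s (k + 1) ^ 2 =
        (G.memory α s k).scale * G.leadDist α s (k + 1) ^ 2 / (4 * G.totalDemand) := fun k => by
    rw [one_div, mul_assoc, inv_mul_eq_div, Memory.scale]
  simp only [← sqSum_memory, hquad] at hadaptive
  rw [← Memory.scale] at hadaptive
  have hnoise : √(2 * ∑ k ∈ Finset.range (n + 1), (α (k + 1) *
      (‖G.recommendNoise α s (k + 1)‖ + ‖G.testNoise α s (k + 1)‖)) ^ 2) ≤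
      2 * √(G.noiseEnergy α s (n + 1)) := by
    refine (Real.sqrt_le_sqrt (y := 2 ^ 2 * G.noiseEnergy α s (n + 1)) ?_).trans_eq ?_
    · linarith [G.sum_sq_mul_norm_add_norm_le s (α := α) (n + 1)]
    · rw [Real.sqrt_mul (sq_nonneg _), Real.sqrt_sq zero_le_two]
  linarith [G.weightSum_mul_potential_sub_add_noiseRegret_le_regret s hα hf n,
    G.regret_add_sum_leadDist_le α s hf (n + 1), mul_le_mul_of_nonneg_left hnoise (half_pos hC).le,
    G.half_constC_mul_sqrt_le hL]

end Noise

end CongestionGame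

namespace CongestionGame

variable {V E I Ω Ξ : Type*} [Fintype I] [MeasurableSpace Ω] {G : CongestionGame V E I Ω}

/-- The components of a random memory are measurable. -/
structure MeasurableMemory [MeasurableSpace Ξ] (m : Ξ → G.Memory) : Prop where
  anchor : Measurable fun ξ => (m ξ).anchor
  score : Measurable fun ξ => (m ξ).score
  sqSum : Measurable fun ξ => (m ξ).sqSum

variable {mΞ : MeasurableSpace Ξ}

section Measurability

variable (G)

theorem measurable_logit : Measurable G.logit := by
  refine (continuous_pi fun r => ?_).measurable
  exact Continuous.div (by fun_prop) (by fun_prop) fun Y => (G.sum_exp_pos Y r.1).ne'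

theorem measurable_pathCost_comp {f : Ξ → G.Route → ℝ} (hf : Measurable f)
    (hmem : ∀ ξ, f ξ ∈ G.feasible) {W : Ξ → Ω} (hW : Measurable W) :
    Measurable fun ξ => G.pathCost (f ξ) (W ξ) :=
  G.measurable_pathCost.comp ((hf.subtype_mk (h := hmem)).prodMk hW)

end Measurability

namespace MeasurableMemory

variable {m : Ξ → G.Memory} (hm : MeasurableMemory m) {α : ℕ → ℝ} {t : ℕ}
include hm

theorem average {y : Ξ → G.Route → ℝ} (hy : Measurable y) :
    Measurable fun ξ => (m ξ).average α t (y ξ) := by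
  have := hm.anchor
  unfold Memory.average
  fun_prop

theorem logit_rate_smul {Y : Ξ → G.Route → ℝ} (hY : Measurable Y) :
    Measurable fun ξ => G.logit ((m ξ).rate • Y ξ) := by
  have := hm.sqSum
  refine G.measurable_logit.comp ?_
  unfold Memory.rate
  fun_prop

theorem testFlow : Measurable fun ξ => (m ξ).testFlow α t :=
  hm.average (hm.logit_rate_smul hm.score)

variable (htest : ∀ ξ, (m ξ).testFlow α t ∈ G.feasible) {W₁ W₂ : Ξ → Ω} (hW₁ : Measurable W₁)
include htest hW₁

theorem leadFlow : Measurable fun ξ => (m ξ).leadFlow α t (W₁ ξ) := by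
  have := hm.score
  have hcost := G.measurable_pathCost_comp hm.testFlow htest hW₁
  refine hm.logit_rate_smul ?_
  unfold Memory.testScore
  fun_prop

theorem recommendedFlow : Measurable fun ξ => (m ξ).recommendedFlow α t (W₁ ξ) :=
  hm.average (hm.leadFlow htest hW₁)

theorem next (hrecommend : ∀ ξ, (m ξ).recommendedFlow α t (W₁ ξ) ∈ G.feasible)
    (hW₂ : Measurable W₂) : MeasurableMemory fun ξ => (m ξ).next α t (W₁ ξ) (W₂ ξ) := by
  have ⟨hanchor, hscore, hsqSum⟩ := hm
  have hlead := hm.leadFlow htest hW₁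
  have htest_cost := G.measurable_pathCost_comp hm.testFlow htest hW₁
  have hcost := G.measurable_pathCost_comp (hm.recommendedFlow htest hW₁) hrecommend hW₂
  constructor <;> simp only [Memory.next] <;> fun_prop

end MeasurableMemory

section Measurability

variable (G)

variable {α : ℕ → ℝ} (hα : IsStepWeight α) {ω : ℕ → Phase → Ξ → Ω} {n : ℕ}
  (hpast : ∀ t ≤ n, ∀ φ, Measurable (ω t φ))
include hα hpast

theorem measurableMemory_memory :
    MeasurableMemory fun ξ => G.memory α (fun t φ => ω t φ ξ) n := by
  induction n with
  | zero => exact ⟨measurable_const, measurable_const, measurable_const⟩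
  | succ n ih =>
    exact (ih fun t ht => hpast t (ht.trans n.le_succ)).next
      (fun ξ => G.testedFlow_mem_feasible (fun t φ => ω t φ ξ) hα n)
      (hpast _ le_rfl Phase.test)
      (fun ξ => G.adaWeight_mem_feasible (fun t φ => ω t φ ξ) hα n)
      (hpast _ le_rfl Phase.recommend)

theorem measurable_testedFlow :
    Measurable fun ξ => G.testedFlow α (fun t φ => ω t φ ξ) (n + 1) :=
  (G.measurableMemory_memory hα hpast).testFlow

variable (htest : Measurable (ω (n + 1) Phase.test))
include htest

theorem measurable_leadingFlow :
    Measurable fun ξ => G.leadingFlow α (fun t φ => ω t φ ξ) (n + 1) :=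
  (G.measurableMemory_memory hα hpast).leadFlow
    (fun ξ => G.testedFlow_mem_feasible (fun t φ => ω t φ ξ) hα n) htest

theorem measurable_adaWeight :
    Measurable fun ξ => G.adaWeight α (fun t φ => ω t φ ξ) (n + 1) :=
  (G.measurableMemory_memory hα hpast).recommendedFlow
    (fun ξ => G.testedFlow_mem_feasible (fun t φ => ω t φ ξ) hα n) htest

end Measurability

section Noise

variable (G) {μ : Measure Ξ} [IsProbabilityMeasure μ] {X Y : Ξ → G.feasible} {W : Ξ → Ω}

theorem integrable_sq_norm_costNoise_comp (hX : AEMeasurable X μ) (hW : AEMeasurable W μ) :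
    Integrable (fun ξ => ‖G.costNoise (X ξ) (W ξ)‖ ^ 2) μ := by
  obtain ⟨B, hB⟩ := G.exists_norm_costNoise_le
  have hmeas := (G.measurable_costNoise.norm.pow_const 2).comp_aemeasurable (hX.prodMk hW)
  refine Integrable.of_bound (C := B ^ 2) hmeas.aestronglyMeasurable
    (Filter.Eventually.of_forall fun ξ => ?_)
  rw [norm_pow, norm_norm]
  exact pow_le_pow_left₀ (norm_nonneg _) (hB _ (X ξ).2 _) 2

theorem integral_sq_norm_costNoise_comp_le (hX : AEMeasurable X μ) (hW : AEMeasurable W μ)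
    (hlaw : μ.map W = G.law) (hind : IndepFun X W μ) :
    ∫ ξ, ‖G.costNoise (X ξ) (W ξ)‖ ^ 2 ∂μ ≤ G.noiseLevel ^ 2 := by
  have := Measure.isProbabilityMeasure_map hX
  rw [integral_comp_prodMk_of_indepFun (g := fun p => ‖G.costNoise p.1 p.2‖ ^ 2) hX hW hind
    (hlaw ▸ G.integrable_sq_norm_costNoise_comp measurable_fst.aemeasurable
      measurable_snd.aemeasurable), hlaw]
  refine (integral_mono_of_nonneg (Filter.Eventually.of_forall fun ξ =>
    integral_nonneg fun s => sq_nonneg _) (integrable_const (G.noiseLevel ^ 2))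
    (Filter.Eventually.of_forall fun ξ => G.integral_sq_norm_costNoise_le (X ξ).2)).trans_eq ?_
  rw [integral_const, probReal_univ, one_smul]

variable {f : G.Route → ℝ} (hf : f ∈ G.feasible)
include hf

theorem integrable_costNoise_comp_dotProduct_sub (hX : AEMeasurable X μ) (hY : AEMeasurable Y μ)
    (hW : AEMeasurable W μ) :
    Integrable (fun ξ => G.costNoise (X ξ) (W ξ) ⬝ᵥ ((Y ξ : G.Route → ℝ) - f)) μ := by
  obtain ⟨B, hB⟩ := G.exists_norm_costNoise_le
  have hnoise := aemeasurable_pi_iff.1 (G.measurable_costNoise.comp_aemeasurable (hX.prodMk hW))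
  have hflow := aemeasurable_pi_iff.1 (measurable_subtype_coe.comp_aemeasurable hY)
  refine Integrable.of_bound (C := B * (2 * G.totalDemand))
    (Finset.aemeasurable_fun_sum _ fun r _ =>
      (hnoise r).mul ((hflow r).sub_const (f r))).aestronglyMeasurable
    (Filter.Eventually.of_forall fun ξ => ?_)
  rw [Real.norm_eq_abs]
  refine (abs_dotProduct_le_norm_mul_sum_abs _ _).trans ?_
  gcongr
  · exact (norm_nonneg _).trans (hB _ (X ξ).2 (W ξ))
  · exact hB _ (X ξ).2 _
  · exact sum_abs_sub_le_of_mem_feasible (Y ξ).2 hf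

theorem integral_costNoise_comp_dotProduct_sub (hX : AEMeasurable X μ) (hY : AEMeasurable Y μ)
    (hW : AEMeasurable W μ) (hlaw : μ.map W = G.law)
    (hind : IndepFun (fun ξ => (X ξ, Y ξ)) W μ) :
    ∫ ξ, G.costNoise (X ξ) (W ξ) ⬝ᵥ ((Y ξ : G.Route → ℝ) - f) ∂μ = 0 := by
  have := Measure.isProbabilityMeasure_map (hX.prodMk hY)
  rw [integral_comp_prodMk_of_indepFun
    (g := fun p => G.costNoise p.1.1 p.2 ⬝ᵥ ((p.1.2 : G.Route → ℝ) - f)) (hX.prodMk hY) hW hind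
    (hlaw ▸ G.integrable_costNoise_comp_dotProduct_sub hf measurable_fst.fst.aemeasurable
      measurable_fst.snd.aemeasurable measurable_snd.aemeasurable), hlaw]
  simp only [G.integral_costNoise_dotProduct (X _).2, integral_zero]

end Noise

end CongestionGame

namespace CongestionGame

variable {V E I Ω Ξ : Type*} [Fintype I] [MeasurableSpace Ω] (G : CongestionGame V E I Ω)
  {mΞ : MeasurableSpace Ξ} {μ : Measure Ξ} {ω : ℕ → Phase → Ξ → Ω}

/-- The states `ω t φ` of the network in the phases of all epochs, random variables on the
probability space `(Ξ, μ)`, are independent with the law that the game prescribes. -/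
structure IsIIDSample (μ : Measure Ξ) (ω : ℕ → Phase → Ξ → Ω) : Prop where
  measurable : ∀ t φ, Measurable (ω t φ)
  map_eq : ∀ t φ, μ.map (ω t φ) = G.law
  iIndepFun : iIndepFun (fun j : ℕ × Phase => ω j.1 j.2) μ

variable {α : ℕ → ℝ} (hα : IsStepWeight α) (hω : G.IsIIDSample μ ω)

namespace IsIIDSample

variable {G}
include hα hω

theorem aemeasurable_testedFlow (n : ℕ) : AEMeasurable (fun ξ =>
    (⟨_, G.testedFlow_mem_feasible (ω · · ξ) hα n⟩ : G.feasible)) μ :=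
  ((G.measurable_testedFlow hα fun t _ => hω.measurable t).subtype_mk).aemeasurable

theorem aemeasurable_adaWeight (n : ℕ) : AEMeasurable (fun ξ =>
    (⟨_, G.adaWeight_mem_feasible (ω · · ξ) hα n⟩ : G.feasible)) μ :=
  ((G.measurable_adaWeight hα (fun t _ => hω.measurable t)
    (hω.measurable _ _)).subtype_mk).aemeasurable

theorem aemeasurable_leadingFlow (n : ℕ) : AEMeasurable (fun ξ =>
    (⟨_, G.leadingFlow_mem_feasible α (ω · · ξ) (n + 1)⟩ : G.feasible)) μ :=
  ((G.measurable_leadingFlow hα (fun t _ => hω.measurable t)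
    (hω.measurable _ _)).subtype_mk).aemeasurable

theorem indepFun_testedFlow (n : ℕ) : IndepFun (fun ξ =>
    (⟨_, G.testedFlow_mem_feasible (ω · · ξ) hα n⟩ : G.feasible)) (ω (n + 1) Phase.test) μ :=
  indepFun_of_measurable_iSup_comap (ω := fun j : ℕ × Phase => ω j.1 j.2)
    (J := {j | j.1 ≤ n}) (j := (n + 1, Phase.test)) (fun j => hω.measurable j.1 j.2)
    hω.iIndepFun (by simp) (G.measurable_testedFlow hα fun t ht φ =>
      measurable_iSup_comap_of_mem (fun j : ℕ × Phase => ω j.1 j.2) (j := (t, φ)) ht).subtype_mk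

theorem indepFun_adaWeight_leadingFlow (n : ℕ) : IndepFun (fun ξ =>
    ((⟨_, G.adaWeight_mem_feasible (ω · · ξ) hα n⟩,
      ⟨_, G.leadingFlow_mem_feasible α (ω · · ξ) (n + 1)⟩) : G.feasible × G.feasible))
    (ω (n + 1) Phase.recommend) μ := by
  refine indepFun_of_measurable_iSup_comap (ω := fun j : ℕ × Phase => ω j.1 j.2)
    (J := {j | j.1 ≤ n ∨ j = (n + 1, Phase.test)}) (j := (n + 1, Phase.recommend))
    (fun j => hω.measurable j.1 j.2) hω.iIndepFun (by simp) ?_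
  have hpast := fun t (ht : t ≤ n) φ =>
    measurable_iSup_comap_of_mem (fun j : ℕ × Phase => ω j.1 j.2)
      (J := {j | j.1 ≤ n ∨ j = (n + 1, Phase.test)}) (j := (t, φ)) (Or.inl ht)
  have htest := measurable_iSup_comap_of_mem (fun j : ℕ × Phase => ω j.1 j.2)
    (J := {j | j.1 ≤ n ∨ j = (n + 1, Phase.test)}) (j := (n + 1, Phase.test)) (Or.inr rfl)
  exact (G.measurable_adaWeight hα hpast htest).subtype_mk.prodMk
    (G.measurable_leadingFlow hα hpast htest).subtype_mk

theorem indepFun_adaWeight (n : ℕ) : IndepFun (fun ξ =>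
    (⟨_, G.adaWeight_mem_feasible (ω · · ξ) hα n⟩ : G.feasible)) (ω (n + 1) Phase.recommend) μ :=
  (hω.indepFun_adaWeight_leadingFlow hα n).comp measurable_fst measurable_id

end IsIIDSample

section Noise

variable [IsProbabilityMeasure μ]
include hα hω

theorem integrable_sq_norm_recommendNoise (n : ℕ) :
    Integrable (fun ξ => ‖G.recommendNoise α (ω · · ξ) (n + 1)‖ ^ 2) μ :=
  (G.integrable_sq_norm_costNoise_comp (hω.aemeasurable_adaWeight hα n)
    (hω.measurable _ _).aemeasurable :)

theorem integral_sq_norm_recommendNoise_le (n : ℕ) :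
    ∫ ξ, ‖G.recommendNoise α (ω · · ξ) (n + 1)‖ ^ 2 ∂μ ≤ G.noiseLevel ^ 2 :=
  (G.integral_sq_norm_costNoise_comp_le (hω.aemeasurable_adaWeight hα n)
    (hω.measurable _ _).aemeasurable (hω.map_eq _ _) (hω.indepFun_adaWeight hα n) :)

theorem integrable_sq_norm_testNoise (n : ℕ) :
    Integrable (fun ξ => ‖G.testNoise α (ω · · ξ) (n + 1)‖ ^ 2) μ :=
  (G.integrable_sq_norm_costNoise_comp (hω.aemeasurable_testedFlow hα n)
    (hω.measurable _ _).aemeasurable :)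

theorem integral_sq_norm_testNoise_le (n : ℕ) :
    ∫ ξ, ‖G.testNoise α (ω · · ξ) (n + 1)‖ ^ 2 ∂μ ≤ G.noiseLevel ^ 2 :=
  (G.integral_sq_norm_costNoise_comp_le (hω.aemeasurable_testedFlow hα n)
    (hω.measurable _ _).aemeasurable (hω.map_eq _ _) (hω.indepFun_testedFlow hα n) :)

theorem integrable_noiseEnergy (n : ℕ) :
    Integrable (fun ξ => G.noiseEnergy α (ω · · ξ) n) μ :=
  integrable_finsetSum _ fun k _ => ((G.integrable_sq_norm_recommendNoise hα hω k).add
    (G.integrable_sq_norm_testNoise hα hω k)).const_mul _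

theorem integral_noiseEnergy_le (n : ℕ) :
    ∫ ξ, G.noiseEnergy α (ω · · ξ) n ∂μ ≤
      2 * G.noiseLevel ^ 2 * ∑ k ∈ Finset.range n, α (k + 1) ^ 2 := by
  have hrecommend := G.integrable_sq_norm_recommendNoise hα hω
  have htest := G.integrable_sq_norm_testNoise hα hω
  simp only [noiseEnergy]
  rw [integral_finsetSum _ fun k _ => ((hrecommend k).fun_add (htest k)).const_mul _,
    Finset.mul_sum]
  refine Finset.sum_le_sum fun k _ => ?_
  rw [integral_const_mul, integral_add (hrecommend k) (htest k), mul_comm, two_mul]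
  gcongr
  · exact G.integral_sq_norm_recommendNoise_le hα hω k
  · exact G.integral_sq_norm_testNoise_le hα hω k

theorem integral_sqrt_noiseEnergy_le (n : ℕ) :
    ∫ ξ, √(G.noiseEnergy α (ω · · ξ) n) ∂μ ≤
      √2 * G.noiseLevel * √(∑ k ∈ Finset.range n, α (k + 1) ^ 2) := by
  refine (integral_sqrt_le_sqrt_integral (G.integrable_noiseEnergy hα hω n)
    (Filter.Eventually.of_forall fun ξ => G.noiseEnergy_nonneg α (ω · · ξ) n)).trans ?_
  refine (Real.sqrt_le_sqrt (G.integral_noiseEnergy_le hα hω n)).trans_eq ?_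
  rw [Real.sqrt_mul (by positivity), Real.sqrt_mul zero_le_two,
    Real.sqrt_sq G.noiseLevel_nonneg]

variable {f : G.Route → ℝ} (hf : f ∈ G.feasible)
include hf

theorem integrable_recommendNoise_dotProduct (n : ℕ) : Integrable (fun ξ =>
    G.recommendNoise α (ω · · ξ) (n + 1) ⬝ᵥ (G.leadingFlow α (ω · · ξ) (n + 1) - f)) μ :=
  (G.integrable_costNoise_comp_dotProduct_sub hf (hω.aemeasurable_adaWeight hα n)
    (hω.aemeasurable_leadingFlow hα n) (hω.measurable _ _).aemeasurable :)

theorem integral_recommendNoise_dotProduct (n : ℕ) :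
    ∫ ξ, G.recommendNoise α (ω · · ξ) (n + 1) ⬝ᵥ (G.leadingFlow α (ω · · ξ) (n + 1) - f) ∂μ = 0 :=
  (G.integral_costNoise_comp_dotProduct_sub hf (hω.aemeasurable_adaWeight hα n)
    (hω.aemeasurable_leadingFlow hα n) (hω.measurable _ _).aemeasurable (hω.map_eq _ _)
    (hω.indepFun_adaWeight_leadingFlow hα n) :)

theorem integrable_noiseRegret (n : ℕ) :
    Integrable (fun ξ => G.noiseRegret α (ω · · ξ) f n) μ :=
  integrable_finsetSum _ fun k _ =>
    (G.integrable_recommendNoise_dotProduct hα hω hf k).const_mul _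

theorem integral_noiseRegret (n : ℕ) : ∫ ξ, G.noiseRegret α (ω · · ξ) f n ∂μ = 0 := by
  simp only [noiseRegret]
  rw [integral_finsetSum _ fun k _ =>
    (G.integrable_recommendNoise_dotProduct hα hω hf k).const_mul _]
  simp only [integral_const_mul, G.integral_recommendNoise_dotProduct hα hω hf, mul_zero,
    Finset.sum_const_zero]

end Noise

section Rate

variable [IsProbabilityMeasure μ] [Fintype E]

theorem integrable_potential_comp {X : Ξ → G.feasible} (hX : AEMeasurable X μ) :
    Integrable (fun ξ => G.potential (X ξ)) μ := by
  obtain ⟨B, hB⟩ := G.exists_abs_potential_sub_le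
  have hmeas := G.continuousOn_potential.domRestrict.measurable.comp_aemeasurable hX
  refine Integrable.of_bound (C := B + |G.potential (G.logit 0)|) hmeas.aestronglyMeasurable
    (Filter.Eventually.of_forall fun ξ => ?_)
  linarith [hB _ (X ξ).2 _ (G.logit_mem_feasible 0), Real.norm_eq_abs (G.potential (X ξ)),
    abs_sub_abs_le_abs_sub (G.potential (X ξ)) (G.potential (G.logit 0))]

include hα hω in
theorem integrable_potential_adaWeight (n : ℕ) :
    Integrable (fun ξ => G.potential (G.adaWeight α (ω · · ξ) (n + 1))) μ :=
  (G.integrable_potential_comp (hω.aemeasurable_adaWeight hα n) :)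

include hα hω in
theorem integrable_gap_adaWeight (n : ℕ) :
    Integrable (fun ξ => G.gap (G.adaWeight α (ω · · ξ) (n + 1))) μ :=
  (G.integrable_potential_adaWeight hα hω n).sub (integrable_const _)

variable [Nonempty I] {L : ℝ} (hL : 0 ≤ L) (hG : G.IsSmoothWith L)
  (hsq : ∀ n, α n ^ 2 ≤ 2 * weightSum α n)
include hα hω hL hG hsq

theorem integral_potential_adaWeight_sub_le {f : G.Route → ℝ} (hf : f ∈ G.feasible) (n : ℕ) :
    ∫ ξ, G.potential (G.adaWeight α (ω · · ξ) (n + 1)) ∂μ - G.potential f ≤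
      (√2 * G.constC * G.noiseLevel * √(∑ k ∈ Finset.range (n + 1), α (k + 1) ^ 2) +
        (8 * L * √(Fintype.card I * G.maxDemand) * G.constC ^ (3 / 2 : ℝ) + G.constC')) /
          weightSum α (n + 1) := by
  have hpotential := G.integrable_potential_adaWeight (μ := μ) hα hω n
  have hregret := G.integrable_noiseRegret hα hω hf (n + 1)
  have hexcess := (hpotential.sub' (integrable_const (G.potential f))).const_mul
    (weightSum α (n + 1))
  have hsqrt := (integrable_sqrt (G.integrable_noiseEnergy hα hω (n + 1))).const_mul G.constC
  have hconst := (integrable_const G.constC').fun_add hsqrt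
  have hmean := integral_mono (hexcess.fun_add hregret)
    (hconst.fun_add (integrable_const
      (8 * L * √(Fintype.card I * G.maxDemand) * G.constC ^ (3 / 2 : ℝ))))
    fun ξ => G.weightSum_mul_potential_sub_add_noiseRegret_le (ω · · ξ) hα hL hG hsq hf n
  rw [integral_add hexcess hregret, G.integral_noiseRegret hα hω hf, integral_const_mul,
    integral_sub hpotential (integrable_const _), integral_add hconst (integrable_const _),
    integral_add (integrable_const _) hsqrt, integral_const_mul] at hmean
  simp only [integral_const, probReal_univ, one_smul] at hmean
  rw [le_div_iff₀' (hα.weightSum_succ_pos n)]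
  linarith [mul_le_mul_of_nonneg_left (G.integral_sqrt_noiseEnergy_le hα hω (n + 1))
    G.constC_pos.le]

theorem integral_gap_adaWeight_le (n : ℕ) :
    ∫ ξ, G.gap (G.adaWeight α (ω · · ξ) (n + 1)) ∂μ ≤
      (√2 * G.constC * G.noiseLevel * √(∑ k ∈ Finset.range (n + 1), α (k + 1) ^ 2) +
        (8 * L * √(Fintype.card I * G.maxDemand) * G.constC ^ (3 / 2 : ℝ) + G.constC')) /
          weightSum α (n + 1) := by
  simp only [gap]
  rw [integral_sub (G.integrable_potential_adaWeight hα hω n) (integrable_const _),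
    integral_const, probReal_univ, one_smul]
  exact G.sub_sInf_potential_le fun f hf =>
    G.integral_potential_adaWeight_sub_le hα hω hL hG hsq hf n

theorem ae_gap_adaWeight_le (hσ : G.noiseLevel = 0) :
    ∀ᵐ ξ ∂μ, ∀ n, G.gap (G.adaWeight α (ω · · ξ) (n + 1)) ≤
      (8 * L * √(Fintype.card I * G.maxDemand) * G.constC ^ (3 / 2 : ℝ) + G.constC') /
        weightSum α (n + 1) := by
  have hσ_sq : G.noiseLevel ^ 2 ≤ 0 := by rw [hσ, zero_pow two_ne_zero]
  have hrecommend := ae_all_iff.2 fun k => ae_eq_zero_of_integral_sq_norm_nonpos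
    (G.integrable_sq_norm_recommendNoise hα hω k)
    ((G.integral_sq_norm_recommendNoise_le hα hω k).trans hσ_sq)
  have htest := ae_all_iff.2 fun k => ae_eq_zero_of_integral_sq_norm_nonpos
    (G.integrable_sq_norm_testNoise hα hω k)
    ((G.integral_sq_norm_testNoise_le hα hω k).trans hσ_sq)
  filter_upwards [hrecommend, htest] with ξ hrecommend htest n
  refine G.sub_sInf_potential_le fun f hf => ?_
  have hbound := G.weightSum_mul_potential_sub_add_noiseRegret_le (ω · · ξ) hα hL hG hsq hf n
  simp only [noiseRegret, noiseEnergy, hrecommend, htest, Pi.zero_apply, zero_dotProduct,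
    norm_zero, ne_eq, OfNat.ofNat_ne_zero, not_false_eq_true, zero_pow, add_zero, mul_zero,
    Finset.sum_const_zero, Real.sqrt_zero] at hbound
  rw [le_div_iff₀' (hα.weightSum_succ_pos n)]
  exact hbound.trans_eq (add_comm _ _)

end Rate

end CongestionGame

theorem isStepWeight_natCast : IsStepWeight (fun t => (t : ℝ)) :=
  ⟨Nat.cast_zero, fun n => Nat.cast_pos.2 n.succ_pos⟩

theorem weightSum_natCast (n : ℕ) : weightSum (fun t => (t : ℝ)) n = n * (n + 1) / 2 := by
  induction n with
  | zero => simp [weightSum]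
  | succ n ih =>
    rw [weightSum_succ, ih]
    push_cast
    ring

theorem sq_natCast_le_two_mul_weightSum (n : ℕ) :
    (n : ℝ) ^ 2 ≤ 2 * weightSum (fun t => (t : ℝ)) n := by
  rw [weightSum_natCast]
  linarith [(n.cast_nonneg : (0 : ℝ) ≤ n)]

theorem div_weightSum_natCast_le {B : ℝ} (hB : 0 ≤ B) {T : ℕ} (hT : 1 ≤ T) :
    B / weightSum (fun t => (t : ℝ)) T ≤ 2 * B / (T : ℝ) ^ 2 := by
  have hT_pos : (0 : ℝ) < T := by exact_mod_cast hT
  rw [weightSum_natCast, div_le_div_iff₀ (by positivity) (by positivity)]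
  nlinarith [mul_nonneg hB hT_pos.le]

theorem sqrt_sum_sq_natCast_le (n : ℕ) :
    √(∑ k ∈ Finset.range n, ((k + 1 : ℕ) : ℝ) ^ 2) ≤ n * √n := by
  have hsum : ∑ k ∈ Finset.range n, ((k + 1 : ℕ) : ℝ) ^ 2 ≤ n * (n : ℝ) ^ 2 := by
    refine (Finset.sum_le_card_nsmul _ _ ((n : ℝ) ^ 2) fun k hk => ?_).trans_eq ?_
    · gcongr
      exact Finset.mem_range.1 hk
    · rw [Finset.card_range, nsmul_eq_mul]
  refine (Real.sqrt_le_sqrt hsum).trans_eq ?_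
  rw [Real.sqrt_mul n.cast_nonneg, Real.sqrt_sq n.cast_nonneg, mul_comm]

namespace CongestionGame

section LinearWeights

variable {V E I Ω Ξ : Type*} [Fintype I] [Nonempty I] [MeasurableSpace Ω]
  (G : CongestionGame V E I Ω) {L : ℝ}

theorem smoothness_term_nonneg (hL : 0 ≤ L) :
    0 ≤ 8 * L * √(Fintype.card I * G.maxDemand) * G.constC ^ (3 / 2 : ℝ) :=
  mul_nonneg (by positivity) (Real.rpow_nonneg G.constC_pos.le _)

variable [Fintype E] {mΞ : MeasurableSpace Ξ} {μ : Measure Ξ} [IsProbabilityMeasure μ]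
  {ω : ℕ → Phase → Ξ → Ω}

theorem integral_gap_adaWeight_natCast_le (hω : G.IsIIDSample μ ω) (hL : 0 ≤ L)
    (hG : G.IsSmoothWith L) {T : ℕ} (hT : 1 ≤ T) :
    ∫ ξ, G.gap (G.adaWeight (fun t => (t : ℝ)) (ω · · ξ) T) ∂μ ≤
      2 * √2 * G.constC * G.noiseLevel / √T +
        (16 * L * √(Fintype.card I * G.maxDemand) * G.constC ^ (3 / 2 : ℝ) + 2 * G.constC') /
          (T : ℝ) ^ 2 := by
  obtain ⟨n, rfl⟩ := Nat.exists_eq_add_of_le' hT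
  refine (G.integral_gap_adaWeight_le isStepWeight_natCast hω hL hG
    sq_natCast_le_two_mul_weightSum n).trans ?_
  have hσ := G.noiseLevel_nonneg
  have hC := G.constC_pos
  have hC' := G.constC'_nonneg
  refine (div_weightSum_natCast_le (add_nonneg (by positivity)
    (add_nonneg (G.smoothness_term_nonneg hL) hC')) hT).trans ?_
  have hsqrt := mul_le_mul_of_nonneg_left (sqrt_sum_sq_natCast_le (n + 1))
    (show 0 ≤ √2 * G.constC * G.noiseLevel by positivity)
  set T : ℝ := ((n + 1 : ℕ) : ℝ)
  have hT_pos : 0 < T := by positivity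
  calc _ ≤ 2 * (√2 * G.constC * G.noiseLevel * (T * √T) +
        (8 * L * √(Fintype.card I * G.maxDemand) * G.constC ^ (3 / 2 : ℝ) + G.constC')) /
          T ^ 2 := by
        gcongr
    _ = 2 * √2 * G.constC * G.noiseLevel * (√T / T) +
        (16 * L * √(Fintype.card I * G.maxDemand) * G.constC ^ (3 / 2 : ℝ) + 2 * G.constC') /
          T ^ 2 := by
        field_simp
        ring
    _ = _ := by rw [Real.sqrt_div_self, ← div_eq_mul_inv]

theorem ae_gap_adaWeight_natCast_le (hω : G.IsIIDSample μ ω) (hL : 0 ≤ L)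
    (hG : G.IsSmoothWith L) (hσ : G.noiseLevel = 0) :
    ∀ᵐ ξ ∂μ, ∀ T : ℕ, 1 ≤ T → G.gap (G.adaWeight (fun t => (t : ℝ)) (ω · · ξ) T) ≤
      (16 * L * √(Fintype.card I * G.maxDemand) * G.constC ^ (3 / 2 : ℝ) + 2 * G.constC') /
        (T : ℝ) ^ 2 := by
  filter_upwards [G.ae_gap_adaWeight_le isStepWeight_natCast hω hL hG
    sq_natCast_le_two_mul_weightSum hσ] with ξ hgap T hT
  obtain ⟨n, rfl⟩ := Nat.exists_eq_add_of_le' hT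
  refine ((hgap n).trans (div_weightSum_natCast_le
    (add_nonneg (G.smoothness_term_nonneg hL) G.constC'_nonneg) hT)).trans_eq ?_
  ring

end LinearWeights

section LogarithmicRate

/-- The constant that dominates the constants of the convergence rate with `a = N M`, up to powers
of `log P`. The absolute values keep it positive also for negative `a`. -/
def rateConst (a L : ℝ) : ℝ := 1 + 126 * |a| + 16 * L * √a * (21 * |a|) ^ (3 / 2 : ℝ)

theorem rateConst_pos (a : ℝ) {L : ℝ} (hL : 0 ≤ L) : 0 < rateConst a L := by
  unfold rateConst
  positivity

theorem mul_le_rateConst {a L : ℝ} (ha : 0 ≤ a) (hL : 0 ≤ L) : 126 * a ≤ rateConst a L := by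
  have : 0 ≤ 16 * L * √a * (21 * a) ^ (3 / 2 : ℝ) := by positivity
  rw [rateConst, abs_of_nonneg ha]
  linarith

theorem le_two_mul_rpow_three_halves {x : ℝ} (hx : 1 / 4 ≤ x) : x ≤ 2 * x ^ (3 / 2 : ℝ) := by
  have hsqrt : 1 / 2 ≤ √x := Real.le_sqrt_of_sq_le (by linarith)
  rw [rpow_three_halves (by linarith)]
  nlinarith

variable {V E I Ω : Type*} [Fintype I] [MeasurableSpace Ω] (G : CongestionGame V E I Ω)

theorem maxDemand_le_totalDemand [Nonempty I] : G.maxDemand ≤ G.totalDemand :=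
  ciSup_le fun i => Finset.single_le_sum (fun j _ => (G.demand_pos j).le) (Finset.mem_univ i)

theorem card_mul_maxDemand_nonneg : 0 ≤ Fintype.card I * G.maxDemand :=
  mul_nonneg (Nat.cast_nonneg _) G.maxDemand_nonneg

theorem log_ratio_le [Nonempty I] :
    Real.log (G.numPaths * G.maxDemand / G.totalDemand) ≤ Real.log G.numPaths := by
  have hratio := G.totalDemand_pos.trans_le G.totalDemand_le_numPaths_mul
  refine Real.log_le_log (div_pos hratio G.totalDemand_pos) ?_
  rw [div_le_iff₀ G.totalDemand_pos]
  exact mul_le_mul_of_nonneg_left G.maxDemand_le_totalDemand (Nat.cast_nonneg _)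

theorem constC'_le [Nonempty I] :
    G.constC' ≤ Fintype.card I * G.maxDemand * Real.log G.numPaths :=
  mul_le_mul G.totalDemand_le (G.log_ratio_le) G.log_ratio_nonneg G.card_mul_maxDemand_nonneg

variable (hP : 2 ≤ G.numPaths)
include hP

theorem lt_log_numPaths : 0.69 < Real.log G.numPaths := by
  have : Real.log 2 ≤ Real.log G.numPaths :=
    Real.log_le_log two_pos (by exact_mod_cast hP)
  linarith [Real.log_two_gt_d9]

variable [Nonempty I]

theorem constC_le : G.constC ≤ 21 * (Fintype.card I * G.maxDemand) * Real.log G.numPaths := by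
  have hfactor : 2 * Real.log (G.numPaths * G.maxDemand / G.totalDemand) + 13 ≤
      21 * Real.log G.numPaths := by
    linarith [G.log_ratio_le, G.lt_log_numPaths hP]
  exact (mul_le_mul_of_nonneg_left hfactor G.card_mul_maxDemand_nonneg).trans_eq (by ring)

variable {L : ℝ} (hL : 0 ≤ L)
include hL

theorem constC_le_rateConst_mul_log :
    G.constC ≤ rateConst (Fintype.card I * G.maxDemand) L * Real.log G.numPaths := by
  have ha := G.card_mul_maxDemand_nonneg
  have hK := mul_le_rateConst ha hL
  refine (G.constC_le hP).trans (mul_le_mul_of_nonneg_right (by linarith) ?_)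
  linarith [G.lt_log_numPaths hP]

theorem constC'_le_rateConst_mul_log :
    G.constC' ≤ rateConst (Fintype.card I * G.maxDemand) L * Real.log G.numPaths := by
  have ha := G.card_mul_maxDemand_nonneg
  have hK := mul_le_rateConst ha hL
  refine (G.constC'_le).trans (mul_le_mul_of_nonneg_right (by linarith) ?_)
  linarith [G.lt_log_numPaths hP]

theorem noise_term_le_rateConst_mul_log_rpow :
    2 * √2 * G.constC ≤
      rateConst (Fintype.card I * G.maxDemand) L * Real.log G.numPaths ^ (3 / 2 : ℝ) := by
  have ha := G.card_mul_maxDemand_nonneg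
  have hlog := G.lt_log_numPaths hP
  have hK := mul_le_rateConst ha hL
  have hsqrt : √2 ≤ (3 / 2 : ℝ) := Real.sqrt_le_iff.2 ⟨by norm_num, by norm_num⟩
  have hpow := le_two_mul_rpow_three_halves (show 1 / 4 ≤ Real.log G.numPaths by linarith)
  calc 2 * √2 * G.constC
      ≤ 2 * (3 / 2) * (21 * (Fintype.card I * G.maxDemand) *
          (2 * Real.log G.numPaths ^ (3 / 2 : ℝ))) := by
        gcongr
        · exact G.constC_pos.le
        · exact (G.constC_le hP).trans (mul_le_mul_of_nonneg_left hpow (by positivity))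
    _ = 126 * (Fintype.card I * G.maxDemand) * Real.log G.numPaths ^ (3 / 2 : ℝ) := by ring
    _ ≤ _ := by gcongr

theorem static_term_le_rateConst_mul_log_rpow :
    16 * L * √(Fintype.card I * G.maxDemand) * G.constC ^ (3 / 2 : ℝ) + 2 * G.constC' ≤
      rateConst (Fintype.card I * G.maxDemand) L * Real.log G.numPaths ^ (3 / 2 : ℝ) := by
  have ha := G.card_mul_maxDemand_nonneg
  have hlog : 1 / 4 ≤ Real.log G.numPaths := by linarith [G.lt_log_numPaths hP]
  have hconst : 2 * G.constC' ≤ 126 * (Fintype.card I * G.maxDemand) *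
      Real.log G.numPaths ^ (3 / 2 : ℝ) := by
    have hpow := mul_le_mul_of_nonneg_left (le_two_mul_rpow_three_halves hlog) ha
    have : 0 ≤ Fintype.card I * G.maxDemand * Real.log G.numPaths ^ (3 / 2 : ℝ) := by positivity
    linarith [G.constC'_le]
  have hsmooth : 16 * L * √(Fintype.card I * G.maxDemand) * G.constC ^ (3 / 2 : ℝ) ≤
      16 * L * √(Fintype.card I * G.maxDemand) *
        ((21 * (Fintype.card I * G.maxDemand)) ^ (3 / 2 : ℝ) *
          Real.log G.numPaths ^ (3 / 2 : ℝ)) := by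
    rw [← Real.mul_rpow (by positivity) (by linarith)]
    gcongr
    · exact G.constC_pos.le
    · exact G.constC_le hP
  have hpos : 0 ≤ Real.log G.numPaths ^ (3 / 2 : ℝ) := Real.rpow_nonneg (by linarith) _
  rw [rateConst, abs_of_nonneg ha]
  linarith

end LogarithmicRate

end CongestionGame

end

open CongestionGame in
theorem mainTheorem1 (N : ℕ) (M L : ℝ) (hL : 0 ≤ L) :
    ∃ K : ℝ, 0 < K ∧
      ∀ {V E I Ω Ξ : Type*} [Fintype E] [Fintype I] [Nonempty I] [MeasurableSpace Ω]
        [MeasurableSpace Ξ] (G : CongestionGame V E I Ω) (μ : Measure Ξ) [IsProbabilityMeasure μ]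
        (ω : ℕ → Phase → Ξ → Ω),
        Fintype.card I = N → G.maxDemand = M → G.IsSmoothWith L →
        (∀ t φ, Measurable (ω t φ)) → (∀ t φ, μ.map (ω t φ) = G.law) →
        iIndepFun (fun j : ℕ × Phase => ω j.1 j.2) μ →
        (∀ T : ℕ, 1 ≤ T →
          Integrable (fun ξ => G.gap (G.adaWeight (fun t => (t : ℝ)) (fun t φ => ω t φ ξ) T)) μ ∧
          ∫ ξ, G.gap (G.adaWeight (fun t => (t : ℝ)) (fun t φ => ω t φ ξ) T) ∂μ ≤
            2 * √2 * G.constC * G.noiseLevel / √(T : ℝ) +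
              (16 * L * √((N : ℝ) * M) * G.constC ^ (3 / 2 : ℝ) + 2 * G.constC') / (T : ℝ) ^ 2) ∧
        (G.noiseLevel = 0 → ∀ᵐ ξ ∂μ, ∀ T : ℕ, 1 ≤ T →
          G.gap (G.adaWeight (fun t => (t : ℝ)) (fun t φ => ω t φ ξ) T) ≤
            (16 * L * √((N : ℝ) * M) * G.constC ^ (3 / 2 : ℝ) + 2 * G.constC') / (T : ℝ) ^ 2) ∧
        0 < G.constC ∧ 0 ≤ G.constC' ∧
        (2 ≤ G.numPaths →
          G.constC ≤ K * Real.log G.numPaths ∧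
          G.constC' ≤ K * Real.log G.numPaths ∧
          (∀ T : ℕ, 1 ≤ T →
            ∫ ξ, G.gap (G.adaWeight (fun t => (t : ℝ)) (fun t φ => ω t φ ξ) T) ∂μ ≤
              K * Real.log G.numPaths ^ (3 / 2 : ℝ) *
                (G.noiseLevel / √(T : ℝ) + 1 / (T : ℝ) ^ 2)) ∧
          (G.noiseLevel = 0 → ∀ᵐ ξ ∂μ, ∀ T : ℕ, 1 ≤ T →
            G.gap (G.adaWeight (fun t => (t : ℝ)) (fun t φ => ω t φ ξ) T) ≤
              K * Real.log G.numPaths ^ (3 / 2 : ℝ) / (T : ℝ) ^ 2)) := by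
  refine ⟨rateConst (N * M) L, rateConst_pos _ hL, ?_⟩
  intro V E I Ω Ξ _ _ _ _ _ G μ _ ω rfl rfl hG hmeas hlaw hindep
  have hω : G.IsIIDSample μ ω := ⟨hmeas, hlaw, hindep⟩
  have hmean := fun T hT => G.integral_gap_adaWeight_natCast_le hω hL hG (T := T) hT
  have hstatic := G.ae_gap_adaWeight_natCast_le hω hL hG
  refine ⟨fun T hT => ⟨?_, hmean T hT⟩, hstatic, G.constC_pos, G.constC'_nonneg, fun hP => ?_⟩
  · obtain ⟨n, rfl⟩ := Nat.exists_eq_add_of_le' hT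
    exact G.integrable_gap_adaWeight isStepWeight_natCast hω n
  have hnoise_term := G.noise_term_le_rateConst_mul_log_rpow hP hL
  have hstatic_term := G.static_term_le_rateConst_mul_log_rpow hP hL
  have hσ_nonneg := G.noiseLevel_nonneg
  refine ⟨G.constC_le_rateConst_mul_log hP hL, G.constC'_le_rateConst_mul_log hP hL,
    fun T hT => (hmean T hT).trans ?_, fun hσ => ?_⟩
  · rw [mul_add, mul_div_assoc, mul_one_div]
    gcongr
  · filter_upwards [hstatic hσ] with ξ hgap T hT
    exact (hgap T hT).trans (by gcongr)
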